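/- **Conventions.** Triangulated categories are locally small; $\mathcal S$ denotes one with small coproducts, and $G\in\mathcal S$ an object. An object $X$ is *compact* if $\mathrm{Hom}(X,-)$ preserves small coproducts. For an interval $I\subseteq\mathbb Z$, possibly unbounded, let $G(I)=\{G[-i]\mid i\in I\}$. For full subcategories, $\mathcal X*\mathcal Y$ consists of all $Z$ in a triangle $X\to Z\to Y\to X[1]$ with $X\in\mathcal X$, $Y\in\mathcal Y$. Let $\mathrm{add}(\mathcal A)$ be the finite direct sums of objects of $\mathcal A$, $\mathrm{coprod}_1(\mathcal A)=\mathrm{add}(\mathcal A)$, $\mathrm{coprod}_{n+1}(\mathcal A)=\mathrm{coprod}_1(\mathcal A)*\mathrm{coprod}_n(\mathcal A)$; let $\mathrm{Coprod}(\mathcal A)$ be the smallest full subcategory containing $\mathcal A$ and closed under small coproducts and extensions. Let $\langle G\rangle^{I}$ be the direct summands of objects of $\bigcup_{n>0}\mathrm{coprod}_n(G(I))$ and $\overline{\langle G\rangle}^{I}$ the direct summands of objects of $\mathrm{Coprod}(G(I))$. $G$ is a *compact generator* if it is compact and $\mathcal S=\overline{\langle G\rangle}^{(-\infty,\infty)}$;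 it is *bounded* if $\mathrm{Hom}(G,G[i])=0$ for $i\ll0$. $\mathcal S$ is *weakly approximable* if there are a compact generator $G$, a t-structure $(\mathcal D^{\le 0},\mathcal D^{\ge 1})$ on $\mathcal S$ and an integer $A>0$ with $G[A]\in\mathcal D^{\le0}$, $\mathrm{Hom}(G[-A],\mathcal D^{\le0})=0$, and such that each $F\in\mathcal D^{\le0}$ lies in a triangle $E\to F\to D\to E[1]$ with $E\in\overline{\langle G\rangle}^{[-A,A]}$, $D\in\mathcal D^{\le-1}$. For a compact generator $G$ of $\mathcal S$ use the t-structure generated by $G$: $\mathcal S^{\le0}=\mathrm{Coprod}(G(-\infty,0])$, $\mathcal S^{\ge1}=G(-\infty,0]^{\perp}$, with $\mathcal S^{\le n}=\mathcal S^{\le0}[-n]$ and $\mathcal S^{\ge n+1}=\mathcal S^{\ge1}[-n]$. Let $\mathcal S^b$ consist of those $X$ with $X[n]\in\mathcal S^{\le0}$ and $X[-n]\in\mathcal S^{\ge1}$ for some $n\ge0$. With values in $\mathbb Z\cup\{\pm\infty\}$ (and $\inf\emptyset=+\infty$) put $$\mathrm{pd}_G(X)=\inf\{n\in\mathbb Z\mid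 \mathrm{Hom}(X,Y[i])=0\ \ \forall i>n,\ Y\in\mathcal S^b\cap\mathcal S^{\le0}\},$$ $$\mathrm{fpd}(\mathcal S,G)=\sup\{\mathrm{pd}_G(X)\mid X\text{ compact},\ X\in\mathcal S^b\cap\mathcal S^{\ge0},\ \mathrm{pd}_G(X)<+\infty\},$$ $$o^-(G)=\inf\{b\ge0\mid \mathrm{Hom}(G[i],G)=0\ \forall i>b\},\qquad o^+(G)=\inf\{c\ge0\mid \mathrm{Hom}(G,G[i])=0\ \forall i>c\},$$ $$w_G(P)=\inf\{\beta-\alpha\mid \alpha\le\beta\text{ integers},\ P\in\langle G\rangle^{[\alpha,\beta]}\},\qquad a(G)=\sup\{b(M)\mid M\in\mathcal S^{\le0}\},$$ where $b(M)$ is the least $n\ge0$ for which there is a triangle $E\to M\to D\to E[1]$ with $E\in\overline{\langle G\rangle}^{[-n,n]}$, $D\in\mathcal S^{\le-1}$. **Theorem.** Let $\mathcal R,\mathcal S,\mathcal T$ be weakly approximable triangulated categories with compact generators $G_{\mathcal R},G_{\mathcal S},G_{\mathcal T}$, and let there be a recollement of $\mathcal S$ by $\mathcal R$ and $\mathcal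 T$, that is, triangle functors $i^*,i^!:\mathcal S\to\mathcal R$, $i_*=i_!:\mathcal R\to\mathcal S$, $j_!,j_*:\mathcal T\to\mathcal S$, $j^!=j^*:\mathcal S\to\mathcal T$ such that $(i^*,i_*)$, $(i_!,i^!)$, $(j_!,j^!)$, $(j^*,j_*)$ are adjoint pairs, $i_*,j_*,j_!$ are fully faithful, $j^*i_*=0$, and for each $Y\in\mathcal S$ the units and counits fit into triangles $i_*i^!Y\to Y\to j_*j^*Y\to i_*i^!Y[1]$ and $j_!j^*Y\to Y\to i_*i^*Y\to j_!j^*Y[1]$. (1) Suppose that $G_{\mathcal S}$ is bounded and $i_*(G_{\mathcal R})$ is compact. Then: (i) If $\mathcal R$ and $\mathcal T$ are nonzero, then $$\begin{aligned}\mathrm{fpd}(\mathcal S,G_{\mathcal S})\le{}&\mathrm{fpd}(\mathcal R,G_{\mathcal R})+w_{G_{\mathcal S}}(i_*(G_{\mathcal R}))+a(G_{\mathcal R})+\mathrm{fpd}(\mathcal T,G_{\mathcal T})+w_{G_{\mathcal S}}(j_!(G_{\mathcal T}))+a(G_{\mathcal T})\\&+o^-(G_{\mathcal S})+o^+(G_{\mathcal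 S})+1.\end{aligned}$$ In any case, if $\mathrm{fpd}(\mathcal R,G_{\mathcal R})<+\infty$ and $\mathrm{fpd}(\mathcal T,G_{\mathcal T})<+\infty$, then $\mathrm{fpd}(\mathcal S,G_{\mathcal S})<+\infty$. (ii) $\mathrm{fpd}(\mathcal R,G_{\mathcal R})\le\mathrm{fpd}(\mathcal S,G_{\mathcal S})+w_{G_{\mathcal R}}(i^*(G_{\mathcal S}))+a(G_{\mathcal S})+o^+(G_{\mathcal R})$. In particular, if $\mathrm{fpd}(\mathcal S,G_{\mathcal S})<+\infty$, then $\mathrm{fpd}(\mathcal R,G_{\mathcal R})<+\infty$. (2) Suppose that $j_!(\mathcal T^{\ge0})\subseteq\mathcal S^{\ge-e}$ for some integer $e$. Then $\mathrm{fpd}(\mathcal T,G_{\mathcal T})\le\mathrm{fpd}(\mathcal S,G_{\mathcal S})+e+d$ for every integer $d$ with $j_!(G_{\mathcal T})\in\langle G_{\mathcal S}\rangle^{(-\infty,d]}$. In particular, if $\mathrm{fpd}(\mathcal S,G_{\mathcal S})<+\infty$, then $\mathrm{fpd}(\mathcal T,G_{\mathcal T})<+\infty$. -/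

import Mathlib

open CategoryTheory CategoryTheory.Limits CategoryTheory.Pretriangulated

universe v u u₁ u₂ u₃

namespace TriCat

noncomputable section

section OneCategory

variable {C : Type u} [Category.{v} C] [HasZeroObject C] [HasShift C ℤ] [Preadditive C]
  [∀ n : ℤ, (shiftFunctor C n).Additive] [Pretriangulated C]

/-- An object `X` is compact if `Hom(X, -)`, as a functor to abelian groups, preserves small
coproducts. -/
def IsCompactObj (X : C) : Prop :=
  ∀ ι : Type v, PreservesColimitsOfShape (Discrete ι) (preadditiveCoyoneda.obj (Opposite.op X))

/-- `G[I] = {G[-i] | i ∈ I}` for a set `I` of integers; for an interval `I = [A, B]`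
(possibly unbounded) this is `G[A, B]`. -/
def shiftsIn (G : C) (I : Set ℤ) : ObjectProperty C :=
  fun X => ∃ i ∈ I, Nonempty (X ≅ G⟦-i⟧)

/-- `add(A)`: the finite direct sums of objects of `A`. -/
def addClosure (A : ObjectProperty C) : ObjectProperty C :=
  fun X => ∃ n : ℕ, A.colimitsOfShape (Discrete (Fin n)) X

/-- `coprod_n(A)` for `n ≥ 1`: `coprod_1(A) = add(A)` and
`coprod_{n+1}(A) = coprod_1(A) * coprod_n(A)`. (The value at `n = 0` is not used.) -/
def coprodN (A : ObjectProperty C) : ℕ → ObjectProperty C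
  | 0 => addClosure A
  | 1 => addClosure A
  | n + 2 => ObjectProperty.extensionProduct (addClosure A) (coprodN A (n + 1))

/-- `⟨G⟩^I`: the union over `n > 0` of `smd(coprod_n(G[I]))`. -/
def gen (G : C) (I : Set ℤ) : ObjectProperty C :=
  fun X => ∃ n : ℕ, 0 < n ∧ (coprodN (shiftsIn G I) n).retractClosure X

/-- `Coprod(A)`: the smallest full subcategory that contains `A` and is closed under small
coproducts and extensions. -/
def bigCoprod (A : ObjectProperty C) : ObjectProperty C :=
  fun X => ∀ Q : ObjectProperty C, A ≤ Q →
    (∀ ι : Type v, Q.IsClosedUnderColimitsOfShape (Discrete ι)) →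
    ObjectProperty.extensionProduct Q Q ≤ Q → Q X

/-- The "big" version of `⟨G⟩^I`: `smd(Coprod(G[I]))`. -/
def bigGen (G : C) (I : Set ℤ) : ObjectProperty C :=
  (bigCoprod (shiftsIn G I)).retractClosure

/-- `G` is a compact generator: `G` is compact and every object lies in
`smd(Coprod(G(-∞, ∞)))`. -/
def IsCompactGenerator (G : C) : Prop :=
  IsCompactObj G ∧ ∀ X : C, bigGen G Set.univ X

/-- `G` is bounded: `Hom(G, G[i]) = 0` for `i ≪ 0`. -/
def IsBoundedGen (G : C) : Prop :=
  ∃ N : ℤ, ∀ i : ℤ, i < N → ∀ f : G ⟶ G⟦i⟧, f = 0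

variable (C) in
/-- Weak approximability, for a triangulated category with small coproducts. -/
def IsWeaklyApproximable : Prop :=
  ∃ (G : C) (t : Triangulated.TStructure C) (A : ℤ), 0 < A ∧ IsCompactGenerator G ∧
    t.le 0 (G⟦A⟧) ∧
    (∀ F : C, t.le 0 F → ∀ f : G⟦-A⟧ ⟶ F, f = 0) ∧
    ∀ F : C, t.le 0 F →
      ObjectProperty.extensionProduct (bigGen G (Set.Icc (-A) A)) (t.le (-1)) F

/-- `S_G^{≤ n} = Coprod(G(-∞, 0])[-n]`, for the t-structure generated by `G`. -/
def tLE (G : C) (n : ℤ) : ObjectProperty C :=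
  (bigCoprod (shiftsIn G (Set.Iic 0))).shift n

/-- `S_G^{≥ n}`, for the t-structure generated by `G`: here `S_G^{≥ 1} = G(-∞, 0]^⊥` and
`S_G^{≥ n} = S_G^{≥ 1}[1 - n]`. -/
def tGE (G : C) (n : ℤ) : ObjectProperty C :=
  (shiftsIn G (Set.Iic 0)).rightOrthogonal.shift (n - 1)

/-- Bounded objects with respect to the t-structure generated by `G`: some `n ≥ 0` satisfies
`X[n] ∈ S_G^{≤ 0}` and `X[-n] ∈ S_G^{≥ 1}`. -/
def IsBoundedObj (G : C) : ObjectProperty C :=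
  fun X => ∃ n : ℕ, tLE G 0 (X⟦(n : ℤ)⟧) ∧ tGE G 1 (X⟦-(n : ℤ)⟧)

/-- The projective dimension of `X` with respect to `G`, in `ℤ ∪ {±∞}`. -/
def pd (G X : C) : EReal :=
  ⨅ (n : ℤ) (_ : ∀ (i : ℤ) (Y : C), n < i → IsBoundedObj G Y → tLE G 0 Y →
    ∀ f : X ⟶ Y⟦i⟧, f = 0), (((n : ℤ) : ℝ) : EReal)

/-- The finitistic dimension `fpd(S, G)`, in `ℤ ∪ {±∞}`. -/
def fpd (G : C) : EReal :=
  ⨆ (X : C) (_ : IsCompactObj X ∧ IsBoundedObj G X ∧ tGE G 0 X ∧ pd G X < ⊤), pd G X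

/-- The lower self-orthogonal index `o⁻(G)`, in `ℕ ∪ {∞}`. -/
def oMinus (G : C) : EReal :=
  ⨅ (b : ℕ) (_ : ∀ i : ℤ, (b : ℤ) < i → ∀ f : G⟦i⟧ ⟶ G, f = 0), (((b : ℕ) : ℝ) : EReal)

/-- The upper self-orthogonal index `o⁺(G)`, in `ℕ ∪ {∞}`. -/
def oPlus (G : C) : EReal :=
  ⨅ (c : ℕ) (_ : ∀ i : ℤ, (c : ℤ) < i → ∀ f : G ⟶ G⟦i⟧, f = 0), (((c : ℕ) : ℝ) : EReal)

/-- The width `w_G(P)`: the least `β - α` with `α ≤ β` and `P ∈ ⟨G⟩^{[α, β]}`. -/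
def width (G P : C) : EReal :=
  ⨅ (α : ℤ) (β : ℤ) (_ : α ≤ β ∧ gen G (Set.Icc α β) P), (((β - α : ℤ) : ℝ) : EReal)

/-- The approximable index `b(M)` of `M ∈ S_G^{≤ 0}`, in `ℕ ∪ {∞}`. -/
def approxIndexObj (G M : C) : EReal :=
  ⨅ (n : ℕ) (_ : ObjectProperty.extensionProduct (bigGen G (Set.Icc (-(n : ℤ)) n))
    (tLE G (-1)) M), (((n : ℕ) : ℝ) : EReal)

/-- The approximable index `a(G)`, in `ℕ ∪ {∞}`. -/
def approxIndex (G : C) : EReal :=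
  ⨆ (M : C) (_ : tLE G 0 M), approxIndexObj G M

end OneCategory

/-- A recollement of `S` by `R` and `T`: six triangle functors
`iPull = i^*`, `iPush = i_* = i_!`, `iShriek = i^!`,
`jShriek = j_!`, `jPull = j^! = j^*`, `jPush = j_*`. -/
structure Recollement
    (R : Type u₁) [Category.{v} R] [HasZeroObject R] [HasShift R ℤ] [Preadditive R]
    [∀ n : ℤ, (shiftFunctor R n).Additive] [Pretriangulated R]
    (S : Type u₂) [Category.{v} S] [HasZeroObject S] [HasShift S ℤ] [Preadditive S]
    [∀ n : ℤ, (shiftFunctor S n).Additive] [Pretriangulated S]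
    (T : Type u₃) [Category.{v} T] [HasZeroObject T] [HasShift T ℤ] [Preadditive T]
    [∀ n : ℤ, (shiftFunctor T n).Additive] [Pretriangulated T] where
  iPull : S ⥤ R
  iPush : R ⥤ S
  iShriek : S ⥤ R
  jShriek : T ⥤ S
  jPull : S ⥤ T
  jPush : T ⥤ S
  [iPullShift : iPull.CommShift ℤ]
  [iPushShift : iPush.CommShift ℤ]
  [iShriekShift : iShriek.CommShift ℤ]
  [jShriekShift : jShriek.CommShift ℤ]
  [jPullShift : jPull.CommShift ℤ]
  [jPushShift : jPush.CommShift ℤ]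
  iPull_triangulated : iPull.IsTriangulated
  iPush_triangulated : iPush.IsTriangulated
  iShriek_triangulated : iShriek.IsTriangulated
  jShriek_triangulated : jShriek.IsTriangulated
  jPull_triangulated : jPull.IsTriangulated
  jPush_triangulated : jPush.IsTriangulated
  /-- the adjoint pair `(i^*, i_*)` -/
  adjI : iPull ⊣ iPush
  /-- the adjoint pair `(i_!, i^!)` -/
  adjI' : iPush ⊣ iShriek
  /-- the adjoint pair `(j_!, j^!)` -/
  adjJ : jShriek ⊣ jPull
  /-- the adjoint pair `(j^*, j_*)` -/
  adjJ' : jPull ⊣ jPush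
  iPush_full : iPush.Full
  iPush_faithful : iPush.Faithful
  jPush_full : jPush.Full
  jPush_faithful : jPush.Faithful
  jShriek_full : jShriek.Full
  jShriek_faithful : jShriek.Faithful
  jPull_iPush : ∀ X : R, IsZero (jPull.obj (iPush.obj X))
  /-- the triangle `i_* i^! Y → Y → j_* j^* Y → i_* i^! Y[1]` -/
  triangle₁ : ∀ Y : S, ∃ h : jPush.obj (jPull.obj Y) ⟶ (iPush.obj (iShriek.obj Y))⟦(1 : ℤ)⟧,
    Triangle.mk (adjI'.counit.app Y) (adjJ'.unit.app Y) h ∈ distTriang S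
  /-- the triangle `j_! j^* Y → Y → i_* i^* Y → j_! j^* Y[1]` -/
  triangle₂ : ∀ Y : S, ∃ h : iPush.obj (iPull.obj Y) ⟶ (jShriek.obj (jPull.obj Y))⟦(1 : ℤ)⟧,
    Triangle.mk (adjJ.counit.app Y) (adjI.unit.app Y) h ∈ distTriang S

end

end TriCat

set_option linter.unusedSectionVars false

/-! All invariants are reduced to integer vanishing statements: `ProjDimLE` and `FinDimLE` bound
projective and finitistic dimension, `SelfExtLE` and `SelfCoextLE` bound Hom between shifts of the
generator, and `AisleLE` and `AisleGE` describe the generated t-structure. Weak approximability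
gives the generator `SelfExtLE` for some constant, so every compact object has finite projective
dimension and the finiteness clause in `fpd` costs nothing.

For the middle term, take a compact `X` in `S^{≥0}` and the triangle `j_! j^* X → X → i_* i^* X`.
Since `i_* GR` is compact, `j^* X` and `i^* X` are compact. As a right adjoint, `j^*` preserves
lower bounds up to a shift, so `fpd` of `T` bounds the projective dimension of `j^* X`.
Approximation (`ApproxBound`) then builds `j^* X`, hence `j_! j^* X`, from shifts `G⟦-i⟧` with `i`
bounded below. This bounds `j_! j^* X` below in the t-structure (cost `o⁻`), hence also `i_* i^* X`
and `i^* X`, and the argument repeats in `R`. Both ends of the triangle are now built from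
controlled shifts of `GS`, and `o⁺` kills their maps to objects far down in the aisle
(`finDimLE_middle`).

For the outer terms, `i_*` and `j_!` are fully faithful, preserve compact objects, and move both
halves of the t-structures by bounded amounts, so a bound pulls back from `S`
(`FinDimLE.of_fullyFaithful`). For `i_*`, the sharp shift of the aisle comes from adjunction and
approximation (`aisleLE_iPush`). -/

namespace TriCat

/-! ### Compactness as finite support of maps into coproducts. -/

noncomputable section Compact

variable {C : Type u} [Category.{v} C] [Preadditive C]

/-- The morphisms to the vertex of a cofan that are finite sums of morphisms factoring through
one of the inclusions. -/
def finiteSupport {ι : Type v} {Y : ι → C} (c : Cofan Y) (X : C) : AddSubgroup (X ⟶ c.pt) :=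
  AddSubgroup.closure {f | ∃ (i : ι) (g : X ⟶ Y i), g ≫ c.inj i = f}

lemma comp_inj_mem_finiteSupport {ι : Type v} {Y : ι → C} (c : Cofan Y) {X : C} {i : ι}
    (g : X ⟶ Y i) : g ≫ c.inj i ∈ finiteSupport c X :=
  AddSubgroup.subset_closure ⟨i, g, rfl⟩

lemma comp_mem_finiteSupport {ι : Type v} {Y : ι → C} (c : Cofan Y) {X X' : C} (u : X' ⟶ X)
    {f : X ⟶ c.pt} (hf : f ∈ finiteSupport c X) : u ≫ f ∈ finiteSupport c X' := by
  induction hf using AddSubgroup.closure_induction with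
  | mem f hf =>
    obtain ⟨i, g, rfl⟩ := hf
    rw [← Category.assoc]
    exact comp_inj_mem_finiteSupport c _
  | zero => simp
  | add f g _ _ hf hg => rw [Preadditive.comp_add]; exact add_mem hf hg
  | neg f _ hf => rw [Preadditive.comp_neg]; exact neg_mem hf

/-- The elementary form of compactness: every morphism to a coproduct has finite support. -/
def IsSmall (X : C) : Prop :=
  ∀ (ι : Type v) (Y : ι → C) (c : Cofan Y), IsColimit c → ∀ f : X ⟶ c.pt, f ∈ finiteSupport c X

section Projections

variable {ι : Type v} {Y : ι → C} {c : Cofan Y} (hc : IsColimit c)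

open Classical in
/-- The projection from a coproduct to one of its summands. -/
def cofanProj (i : ι) : c.pt ⟶ Y i :=
  Cofan.IsColimit.desc hc fun j => if h : j = i then eqToHom (by rw [h]) else 0

lemma inj_cofanProj_self (i : ι) : c.inj i ≫ cofanProj hc i = 𝟙 _ := by
  simp [cofanProj]

lemma inj_cofanProj_of_ne {i j : ι} (h : j ≠ i) : c.inj j ≫ cofanProj hc i = 0 := by
  simp [cofanProj, h]

lemma exists_finset_of_mem_finiteSupport {X : C} {f : X ⟶ c.pt} (hf : f ∈ finiteSupport c X) :
    ∃ s : Finset ι, ∀ t : Finset ι, s ⊆ t → ∑ i ∈ t, f ≫ cofanProj hc i ≫ c.inj i = f := by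
  classical
  induction hf using AddSubgroup.closure_induction with
  | mem f hf =>
    obtain ⟨i, g, rfl⟩ := hf
    refine ⟨{i}, fun t ht => ?_⟩
    rw [Finset.sum_eq_single_of_mem i (ht (by simp))]
    · rw [Category.assoc, ← Category.assoc (c.inj i), inj_cofanProj_self, Category.id_comp]
    · intro j _ hj
      rw [Category.assoc, ← Category.assoc (c.inj i), inj_cofanProj_of_ne hc hj.symm]
      simp
  | zero => exact ⟨∅, by simp⟩
  | add f g _ _ hf hg =>
    obtain ⟨s, hs⟩ := hf
    obtain ⟨t, ht⟩ := hg
    refine ⟨s ∪ t, fun r hr => ?_⟩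
    simp only [Preadditive.add_comp, Finset.sum_add_distrib]
    rw [hs r (Finset.union_subset_left hr), ht r (Finset.union_subset_right hr)]
  | neg f _ hf =>
    obtain ⟨s, hs⟩ := hf
    exact ⟨s, fun t ht => by simp [hs t ht]⟩

lemma finite_support_of_mem_finiteSupport {X : C} {f : X ⟶ c.pt} (hf : f ∈ finiteSupport c X) :
    {i | f ≫ cofanProj hc i ≠ 0}.Finite := by
  induction hf using AddSubgroup.closure_induction with
  | mem f hf =>
    obtain ⟨i, g, rfl⟩ := hf
    refine (Set.finite_singleton i).subset fun j hj => ?_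
    by_contra h
    exact hj (by rw [Category.assoc, inj_cofanProj_of_ne hc (fun e => h e.symm)]; simp)
  | zero => simp
  | add f g _ _ hf hg =>
    refine (hf.union hg).subset fun j hj => ?_
    by_contra h
    simp only [Set.mem_union, Set.mem_ofPred_eq, not_or, not_not] at h
    exact hj (by rw [Preadditive.add_comp, h.1, h.2, add_zero])
  | neg f _ hf => simpa using hf

end Projections

/-- The quotient of `Hom(X, ∐ Y)` by the finitely supported maps receives the zero map from every
`Hom(X, Y i)`. As `Hom(X, ∐ Y)` is the coproduct of these groups, the quotient map is zero. -/
lemma IsCompactObj.isSmall {X : C} (hX : IsCompactObj X) : IsSmall X := by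
  intro ι Y c hc f
  have := hX ι
  have hc' := isColimitOfPreserves (preadditiveCoyoneda.obj (Opposite.op X)) hc
  let H := finiteSupport c X
  let q : (preadditiveCoyoneda.obj (Opposite.op X)).obj c.pt ⟶
      AddCommGrpCat.of ((X ⟶ c.pt) ⧸ H) := AddCommGrpCat.ofHom (QuotientAddGroup.mk' H)
  have hq : q = 0 := by
    refine hc'.hom_ext fun i => ?_
    ext g
    exact (QuotientAddGroup.eq_zero_iff _).2 (comp_inj_mem_finiteSupport c g)
  have : q f = 0 := by rw [hq]; rfl
  exact (QuotientAddGroup.eq_zero_iff (N := H) f).1 this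

lemma IsSmall.isCompactObj {X : C} (hX : IsSmall X) : IsCompactObj X := by
  intro ι
  suffices h : ∀ Y : ι → C, PreservesColimit (Discrete.functor Y)
      (preadditiveCoyoneda.obj (Opposite.op X)) from preservesColimitsOfShape_of_discrete _
  refine fun Y => ⟨fun {c} hc => ⟨?_⟩⟩
  classical
  have hfin (f : X ⟶ c.pt) := finite_support_of_mem_finiteSupport (c := c) hc (hX ι Y c hc f)
  let F := preadditiveCoyoneda.obj (Opposite.op X)
  let comp (s : Cocone (Discrete.functor Y ⋙ F)) (i : ι) : (X ⟶ Y i) →+ s.pt :=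
    (s.ι.app ⟨i⟩).hom
  have hsupp (s : Cocone (Discrete.functor Y ⋙ F)) (f : X ⟶ c.pt) :
      (Function.support fun i => comp s i (f ≫ cofanProj (c := c) hc i)).Finite := by
    refine (hfin f).subset fun i hi h => hi ?_
    simp only [h, map_zero]
  -- The induced map adds up the values on the components of `f`, a finite sum by `hfin`.
  refine
    { desc := fun s => AddCommGrpCat.ofHom
        (AddMonoidHom.mk' (fun f : X ⟶ c.pt => ∑ᶠ i, comp s i (f ≫ cofanProj (c := c) hc i))
          fun f g => ?_)
      fac := fun s j => ?_
      uniq := fun s m hm => ?_ }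
  · rw [← finsum_add_distrib (hsupp s f) (hsupp s g)]
    refine finsum_congr fun i => ?_
    rw [← map_add]
    exact congrArg _ (Preadditive.add_comp _ _ _ f g _)
  · obtain ⟨j⟩ := j
    ext (g : X ⟶ Y j)
    change ∑ᶠ i, comp s i ((g ≫ c.ι.app ⟨j⟩) ≫ cofanProj (c := c) hc i) = comp s j g
    rw [finsum_eq_single _ j]
    · rw [Category.assoc]
      erw [inj_cofanProj_self (c := c) hc j]
      rw [Category.comp_id]
    · intro i hi
      rw [Category.assoc]
      erw [inj_cofanProj_of_ne (c := c) hc hi.symm]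
      simp
  · ext (f : X ⟶ c.pt)
    change m f = ∑ᶠ i, comp s i (f ≫ cofanProj (c := c) hc i)
    obtain ⟨t, ht⟩ := exists_finset_of_mem_finiteSupport (c := c) hc (hX ι Y c hc f)
    have hm' (i : ι) (g : X ⟶ Y i) : m.hom (g ≫ c.ι.app ⟨i⟩) = comp s i g :=
      ConcreteCategory.congr_hom (hm ⟨i⟩) g
    rw [finsum_eq_sum_of_support_subset (s := t ∪ (hfin f).toFinset)]
    · have h0 := ht (t ∪ (hfin f).toFinset) Finset.subset_union_left
      have h1 : m.hom f = m.hom (∑ i ∈ t ∪ (hfin f).toFinset,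
          f ≫ cofanProj (c := c) hc i ≫ c.ι.app ⟨i⟩) := congrArg m.hom h0.symm
      refine h1.trans ((map_sum m.hom _ _).trans (Finset.sum_congr rfl fun i _ => ?_))
      rw [← hm', Category.assoc]
    · intro i hi
      simp only [Finset.coe_union, Set.Finite.coe_toFinset, Set.mem_union]
      exact Or.inr fun h => hi (by simp only [h, map_zero])

end Compact

/-! ### Stability of compactness under retracts, adjoints, shifts and extensions. -/

section SmallClosure

variable {C : Type u} [Category.{v} C] [Preadditive C]

lemma IsSmall.of_retract {X Y : C} (h : Retract X Y) (hY : IsSmall Y) : IsSmall X := by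
  intro ι Z c hc f
  simpa using comp_mem_finiteSupport c h.i (hY ι Z c hc (h.r ≫ f))

lemma isSmall_of_isZero {X : C} (hX : IsZero X) : IsSmall X := by
  intro ι Z c hc f
  rw [hX.eq_of_src f 0]
  exact zero_mem _

variable {D : Type u₁} [Category.{v} D] [Preadditive D]

/-- The image of a colimit cofan under a functor preserving coproducts. -/
noncomputable def isColimitMapCofan (F : C ⥤ D) [PreservesColimitsOfSize.{v, v} F] {ι : Type v} {Y : ι → C}
    {c : Cofan Y} (hc : IsColimit c) :
    IsColimit (Cofan.mk (F.obj c.pt) fun i => F.map (c.inj i)) :=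
  isColimitCofanMkObjOfIsColimit F _ _ (hc.ofIsoColimit (Cocone.ext (Iso.refl _)))

lemma IsSmall.obj_of_adjunction {F : C ⥤ D} {U : D ⥤ C} [F.Additive] (adj : F ⊣ U)
    [PreservesColimitsOfSize.{v, v} U] {X : C} (hX : IsSmall X) : IsSmall (F.obj X) := by
  intro ι Y c hc f
  have h := hX ι _ _ (isColimitMapCofan U hc) (adj.homEquiv _ _ f)
  have key (g : X ⟶ U.obj c.pt) (hg : g ∈ finiteSupport
      (Cofan.mk (U.obj c.pt) fun i => U.map (c.inj i)) X) :
      F.map g ≫ adj.counit.app _ ∈ finiteSupport c (F.obj X) := by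
    induction hg using AddSubgroup.closure_induction with
    | mem g hg =>
      obtain ⟨i, k, rfl⟩ := hg
      have : F.map (k ≫ (Cofan.mk (U.obj c.pt) fun i => U.map (c.inj i)).inj i) ≫
          adj.counit.app c.pt = (F.map k ≫ adj.counit.app _) ≫ c.inj i := by
        simp [Cofan.inj]
      rw [this]
      exact comp_inj_mem_finiteSupport c _
    | zero => rw [F.map_zero, zero_comp]; exact zero_mem _
    | add f g _ _ hf hg => rw [F.map_add, Preadditive.add_comp]; exact add_mem hf hg
    | neg f _ hf => rw [F.map_neg, Preadditive.neg_comp]; exact neg_mem hf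
  have hf : F.map (adj.homEquiv _ _ f) ≫ adj.counit.app _ = f := by
    simp [Adjunction.homEquiv_unit]
  rw [← hf]
  exact key _ h

lemma IsSmall.of_obj {F : C ⥤ D} [F.Additive] [F.Full] [F.Faithful]
    [PreservesColimitsOfSize.{v, v} F] {X : C} (hX : IsSmall (F.obj X)) : IsSmall X := by
  intro ι Y c hc f
  have key (g : F.obj X ⟶ F.obj c.pt) (hg : g ∈ finiteSupport
      (Cofan.mk (F.obj c.pt) fun i => F.map (c.inj i)) (F.obj X)) :
      F.preimage g ∈ finiteSupport c X := by
    induction hg using AddSubgroup.closure_induction with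
    | mem g hg =>
      obtain ⟨i, k, rfl⟩ := hg
      have : F.preimage (k ≫ (Cofan.mk (F.obj c.pt) fun i => F.map (c.inj i)).inj i) =
          F.preimage k ≫ c.inj i := F.map_injective (by simp [Cofan.inj])
      rw [this]
      exact comp_inj_mem_finiteSupport c _
    | zero =>
      rw [show F.preimage (0 : F.obj X ⟶ F.obj c.pt) = 0 from F.map_injective (by simp)]
      exact zero_mem _
    | add f g _ _ hf hg =>
      rw [show F.preimage (f + g) = F.preimage f + F.preimage g from
        F.map_injective (by simp [F.map_add])]
      exact add_mem hf hg
    | neg f _ hf =>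
      rw [show F.preimage (-f) = -F.preimage f from F.map_injective (by simp [F.map_neg])]
      exact neg_mem hf
  simpa using key _ (hX ι _ _ (isColimitMapCofan F hc) (F.map f))

end SmallClosure

section Triangulated

variable {C : Type u} [Category.{v} C] [HasZeroObject C] [HasShift C ℤ] [Preadditive C]
  [∀ n : ℤ, (shiftFunctor C n).Additive] [Pretriangulated C]

lemma IsSmall.shift {X : C} (hX : IsSmall X) (n : ℤ) : IsSmall (X⟦n⟧) :=
  have : (shiftEquiv C n).functor.Additive := inferInstanceAs (shiftFunctor C n).Additive
  hX.obj_of_adjunction (shiftEquiv C n).toAdjunction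

lemma IsSmall.ext₂ (T : Triangle C) (hT : T ∈ distTriang C) (h₁ : IsSmall T.obj₁)
    (h₃ : IsSmall T.obj₃) : IsSmall T.obj₂ := by
  intro ι Y c hc f
  -- Removing from `f` its components in the support `s` of the restriction to `T.obj₁` leaves a map
  -- that factors through `T.obj₃`.
  obtain ⟨s, hs⟩ := exists_finset_of_mem_finiteSupport hc (h₁ ι Y c hc (T.mor₁ ≫ f))
  obtain ⟨g, hg⟩ := Triangle.yoneda_exact₂ T hT
    (f - ∑ i ∈ s, f ≫ cofanProj hc i ≫ c.inj i) (by
      rw [Preadditive.comp_sub, sub_eq_zero]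
      refine (hs s subset_rfl).symm.trans ?_
      simp [Preadditive.comp_sum])
  rw [sub_eq_iff_eq_add] at hg
  rw [hg]
  refine add_mem (comp_mem_finiteSupport c _ (h₃ ι Y c hc g)) (sum_mem fun i _ => ?_)
  rw [← Category.assoc]
  exact comp_inj_mem_finiteSupport c _

lemma IsSmall.ext₁ (T : Triangle C) (hT : T ∈ distTriang C) (h₂ : IsSmall T.obj₂)
    (h₃ : IsSmall T.obj₃) : IsSmall T.obj₁ :=
  IsSmall.ext₂ _ (inv_rot_of_distTriang _ hT) (h₃.shift (-1)) h₂

end Triangulated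

open scoped ZeroObject

/-! ### Objects built by extensions, coproducts and retracts, and Hom-vanishing along such
constructions. -/

section Built

variable {C : Type u} [Category.{v} C] [HasZeroObject C] [HasShift C ℤ] [Preadditive C]
  [∀ n : ℤ, (shiftFunctor C n).Additive] [Pretriangulated C]

/-- The objects obtained from `A` by finitely many extensions and passages to retracts. -/
inductive FinBuilt (A : ObjectProperty C) : C → Prop
  | of {X : C} (h : A X) : FinBuilt A X
  | zero {X : C} (h : IsZero X) : FinBuilt A X
  | retract {X Y : C} (r : Retract X Y) (h : FinBuilt A Y) : FinBuilt A X
  | ext (T : Triangle C) (hT : T ∈ distTriang C) (h₁ : FinBuilt A T.obj₁)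
      (h₃ : FinBuilt A T.obj₃) : FinBuilt A T.obj₂

/-- The objects obtained from `A` by small coproducts, extensions and retracts. -/
inductive Built (A : ObjectProperty C) : C → Prop
  | of {X : C} (h : A X) : Built A X
  | coprod {ι : Type v} {Y : ι → C} (c : Cofan Y) (hc : IsColimit c) (h : ∀ i, Built A (Y i)) :
      Built A c.pt
  | retract {X Y : C} (r : Retract X Y) (h : Built A Y) : Built A X
  | ext (T : Triangle C) (hT : T ∈ distTriang C) (h₁ : Built A T.obj₁)
      (h₃ : Built A T.obj₃) : Built A T.obj₂

variable {A A' : ObjectProperty C}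

lemma FinBuilt.of_iso {X Y : C} (e : X ≅ Y) (h : FinBuilt A X) : FinBuilt A Y :=
  .retract e.symm.retract h

lemma Built.of_iso {X Y : C} (e : X ≅ Y) (h : Built A X) : Built A Y :=
  .retract e.symm.retract h

lemma Built.zero {X : C} (h : IsZero X) : Built A X := by
  let c : Cofan (PEmpty.elim : PEmpty.{v + 1} → C) := Cofan.mk X fun i => i.elim
  have hc : IsColimit c := Cofan.IsColimit.mk _ (fun s => h.to_ _) (fun s i => i.elim)
    (fun s m _ => h.eq_of_src _ _)
  exact Built.coprod _ hc (fun i => i.elim)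

lemma FinBuilt.built {X : C} (h : FinBuilt A X) : Built A X := by
  induction h with
  | of h => exact .of h
  | zero h => exact .zero h
  | retract r _ h => exact .retract r h
  | ext T hT _ _ h₁ h₃ => exact .ext T hT h₁ h₃

lemma FinBuilt.trans {X : C} (h : FinBuilt A X) (hA : ∀ Y, A Y → FinBuilt A' Y) :
    FinBuilt A' X := by
  induction h with
  | of h => exact hA _ h
  | zero h => exact .zero h
  | retract r _ h => exact .retract r h
  | ext T hT _ _ h₁ h₃ => exact .ext T hT h₁ h₃

lemma Built.trans {X : C} (h : Built A X) (hA : ∀ Y, A Y → Built A' Y) : Built A' X := by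
  induction h with
  | of h => exact hA _ h
  | coprod c hc _ h => exact .coprod c hc h
  | retract r _ h => exact .retract r h
  | ext T hT _ _ h₁ h₃ => exact .ext T hT h₁ h₃

lemma FinBuilt.shift {X : C} (h : FinBuilt A X) (n : ℤ) (hA : ∀ Y, A Y → FinBuilt A' (Y⟦n⟧)) :
    FinBuilt A' (X⟦n⟧) := by
  induction h with
  | of h => exact hA _ h
  | zero h => exact .zero ((shiftFunctor C n).map_isZero h)
  | retract r _ h => exact .retract (r.map _) h
  | ext T hT _ _ h₁ h₃ => exact .ext _ (Triangle.shift_distinguished T hT n) h₁ h₃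

lemma Built.shift {X : C} (h : Built A X) (n : ℤ) (hA : ∀ Y, A Y → Built A' (Y⟦n⟧)) :
    Built A' (X⟦n⟧) := by
  induction h with
  | of h => exact hA _ h
  | coprod c hc _ h => exact .coprod _ (isColimitMapCofan (shiftFunctor C n) hc) h
  | retract r _ h => exact .retract (r.map _) h
  | ext T hT _ _ h₁ h₃ => exact .ext _ (Triangle.shift_distinguished T hT n) h₁ h₃

section Functor

variable {D : Type u₁} [Category.{v} D] [HasZeroObject D] [HasShift D ℤ] [Preadditive D]
  [∀ n : ℤ, (shiftFunctor D n).Additive] [Pretriangulated D] {B : ObjectProperty D}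
  (F : C ⥤ D) [F.CommShift ℤ] [F.IsTriangulated]

lemma FinBuilt.map {X : C} (h : FinBuilt A X) (hA : ∀ Y, A Y → FinBuilt B (F.obj Y)) :
    FinBuilt B (F.obj X) := by
  induction h with
  | of h => exact hA _ h
  | zero h => exact .zero (F.map_isZero h)
  | retract r _ h => exact .retract (r.map _) h
  | ext T hT _ _ h₁ h₃ => exact .ext _ (F.map_distinguished T hT) h₁ h₃

lemma Built.map [PreservesColimitsOfSize.{v, v} F] {X : C} (h : Built A X)
    (hA : ∀ Y, A Y → Built B (F.obj Y)) : Built B (F.obj X) := by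
  induction h with
  | of h => exact hA _ h
  | coprod c hc _ h => exact .coprod _ (isColimitMapCofan F hc) h
  | retract r _ h => exact .retract (r.map _) h
  | ext T hT _ _ h₁ h₃ => exact .ext _ (F.map_distinguished T hT) h₁ h₃

end Functor

/-- All morphisms from `X` to `Y` are zero. -/
def HomZero (X Y : C) : Prop := ∀ f : X ⟶ Y, f = 0

lemma HomZero.of_retract_left {X X' Y : C} (h : HomZero X Y) (r : Retract X' X) :
    HomZero X' Y := fun f => by
  rw [← Category.id_comp f, ← r.retract, Category.assoc, h (r.r ≫ f), comp_zero]

lemma HomZero.of_retract_right {X Y Y' : C} (h : HomZero X Y) (r : Retract Y' Y) :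
    HomZero X Y' := fun f => by
  rw [← Category.comp_id f, ← r.retract, ← Category.assoc, h (f ≫ r.i), zero_comp]

lemma HomZero.of_iso_left {X X' Y : C} (h : HomZero X Y) (e : X ≅ X') : HomZero X' Y :=
  h.of_retract_left e.symm.retract

lemma HomZero.of_iso_right {X Y Y' : C} (h : HomZero X Y) (e : Y ≅ Y') : HomZero X Y' :=
  h.of_retract_right e.symm.retract

lemma HomZero.ext_left {Z : C} (T : Triangle C) (hT : T ∈ distTriang C) (h₁ : HomZero T.obj₁ Z)
    (h₃ : HomZero T.obj₃ Z) : HomZero T.obj₂ Z := fun f => by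
  obtain ⟨g, rfl⟩ := Triangle.yoneda_exact₂ T hT f (h₁ _)
  rw [h₃ g, comp_zero]

lemma HomZero.ext_right {Z : C} (T : Triangle C) (hT : T ∈ distTriang C)
    (h₁ : HomZero Z T.obj₁) (h₃ : HomZero Z T.obj₃) : HomZero Z T.obj₂ := fun f => by
  obtain ⟨g, rfl⟩ := Triangle.coyoneda_exact₂ T hT f (h₃ _)
  rw [h₁ g, zero_comp]

lemma homZero_obj_iff_of_adjunction {D : Type u₁} [Category.{v} D] [HasZeroObject D]
    [HasShift D ℤ] [Preadditive D] [∀ n : ℤ, (shiftFunctor D n).Additive] [Pretriangulated D]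
    {F : C ⥤ D} {U : D ⥤ C} [F.Additive] (adj : F ⊣ U) (X : C) (Y : D) :
    HomZero (F.obj X) Y ↔ HomZero X (U.obj Y) := by
  have := adj.right_adjoint_additive
  refine ⟨fun h f => ?_, fun h f => ?_⟩
  · apply (adj.homEquiv X Y).symm.injective
    rw [h ((adj.homEquiv X Y).symm f), h ((adj.homEquiv X Y).symm 0)]
  · apply (adj.homEquiv X Y).injective
    rw [h (adj.homEquiv X Y f), h (adj.homEquiv X Y 0)]

lemma homZero_map_iff {D : Type u₁} [Category.{v} D] [HasZeroObject D]
    [HasShift D ℤ] [Preadditive D] [∀ n : ℤ, (shiftFunctor D n).Additive] [Pretriangulated D]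
    (F : C ⥤ D) [F.Additive] [F.Full] [F.Faithful] (X Y : C) :
    HomZero (F.obj X) (F.obj Y) ↔ HomZero X Y := by
  refine ⟨fun h f => F.map_injective (by rw [h (F.map f), F.map_zero]), fun h f => ?_⟩
  obtain ⟨g, rfl⟩ := F.map_surjective f
  rw [h g, F.map_zero]

lemma homZero_shift_iff (X Y : C) (n : ℤ) : HomZero (X⟦n⟧) (Y⟦n⟧) ↔ HomZero X Y :=
  homZero_map_iff (shiftFunctor C n) X Y

lemma homZero_shift_left_iff (X Y : C) (n m : ℤ) (h : n + m = 0) :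
    HomZero (X⟦n⟧) Y ↔ HomZero X (Y⟦m⟧) := by
  rw [← homZero_shift_iff (X⟦n⟧) Y m]
  let e : (X⟦n⟧)⟦m⟧ ≅ X := (shiftFunctorCompIsoId C n m h).app X
  exact ⟨fun h => h.of_iso_left e, fun h => h.of_iso_left e.symm⟩

lemma Built.homZero_left {X Z : C} (h : Built A X) (hA : ∀ Y, A Y → HomZero Y Z) :
    HomZero X Z := by
  induction h with
  | of h => exact hA _ h
  | coprod c hc _ h =>
    refine fun f => Cofan.IsColimit.hom_ext hc _ _ fun i => ?_
    rw [h i (c.inj i ≫ f), comp_zero]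
  | retract r _ h => exact h.of_retract_left r
  | ext T hT _ _ h₁ h₃ => exact HomZero.ext_left T hT h₁ h₃

lemma Built.homZero_right {X Z : C} (h : Built A X) (hZ : IsSmall Z)
    (hA : ∀ Y, A Y → HomZero Z Y) : HomZero Z X := by
  induction h with
  | of h => exact hA _ h
  | coprod c hc _ h =>
    intro f
    have hf := hZ _ _ c hc f
    induction hf using AddSubgroup.closure_induction with
    | mem f hf =>
      obtain ⟨i, g, rfl⟩ := hf
      rw [h i g, zero_comp]
    | zero => rfl
    | add f g _ _ hf hg => rw [hf, hg, add_zero]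
    | neg f _ hf => rw [hf, neg_zero]
  | retract r _ h => exact h.of_retract_right r
  | ext T hT _ _ h₁ h₃ => exact HomZero.ext_right T hT h₁ h₃

lemma FinBuilt.isSmall {X : C} (h : FinBuilt A X) (hA : ∀ Y, A Y → IsSmall Y) : IsSmall X := by
  induction h with
  | of h => exact hA _ h
  | zero h => exact isSmall_of_isZero h
  | retract r _ h => exact h.of_retract r
  | ext T hT _ _ h₁ h₃ => exact IsSmall.ext₂ T hT h₁ h₃

lemma FinBuilt.biprod {X Y : C} (hX : FinBuilt A X) (hY : FinBuilt A Y) : FinBuilt A (X ⊞ Y) :=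
  .ext _ (binaryBiproductTriangle_distinguished X Y) hX hY

/-- A morphism that factors through an object finitely built from `A`. -/
def FactorsThrough (A : ObjectProperty C) {X Y : C} (f : X ⟶ Y) : Prop :=
  ∃ (Z : C) (_ : FinBuilt A Z) (g : X ⟶ Z) (h : Z ⟶ Y), g ≫ h = f

lemma FactorsThrough.comp {X Y Z : C} {f : X ⟶ Y} (hf : FactorsThrough A f) (g : Y ⟶ Z) :
    FactorsThrough A (f ≫ g) := by
  obtain ⟨W, hW, a, b, rfl⟩ := hf
  exact ⟨W, hW, a, b ≫ g, by simp⟩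

lemma FactorsThrough.add {X Y : C} {f g : X ⟶ Y} (hf : FactorsThrough A f)
    (hg : FactorsThrough A g) : FactorsThrough A (f + g) := by
  obtain ⟨V, hV, a, b, rfl⟩ := hf
  obtain ⟨W, hW, a', b', rfl⟩ := hg
  exact ⟨V ⊞ W, hV.biprod hW, biprod.lift a a', biprod.desc b b', by simp⟩

lemma FactorsThrough.neg {X Y : C} {f : X ⟶ Y} (hf : FactorsThrough A f) :
    FactorsThrough A (-f) := by
  obtain ⟨W, hW, a, b, rfl⟩ := hf
  exact ⟨W, hW, a, -b, by simp⟩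

lemma factorsThrough_zero (X Y : C) : FactorsThrough A (0 : X ⟶ Y) :=
  ⟨0, .zero (isZero_zero C), 0, 0, by simp⟩

/-- The induction lets `X` vary because the extension case applies the hypothesis for `T.obj₁` to
the fibre of a map out of `X`, which is again compact. -/
lemma Built.factorsThrough {Y : C} (hY : Built A Y) (hA : ∀ Z, A Z → IsSmall Z) {X : C}
    (hX : IsSmall X) (f : X ⟶ Y) : FactorsThrough A f := by
  induction hY generalizing X with
  | of h => exact ⟨_, .of h, f, 𝟙 _, by simp⟩
  | coprod c hc _ h =>
    have hf := hX _ _ c hc f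
    induction hf using AddSubgroup.closure_induction with
    | mem f hf =>
      obtain ⟨i, g, rfl⟩ := hf
      exact (h i hX g).comp _
    | zero => exact factorsThrough_zero _ _
    | add f g _ _ hf hg => exact hf.add hg
    | neg f _ hf => exact hf.neg
  | retract r _ h =>
    have := (h hX (f ≫ r.i)).comp r.r
    rwa [Category.assoc, r.retract, Category.comp_id] at this
  | ext T hT _ _ h₁ h₃ =>
    obtain ⟨a₃, ha₃, p, q, hpq⟩ := h₃ hX (f ≫ T.mor₂)
    obtain ⟨b, i, δ, hb⟩ := distinguished_cocone_triangle₁ p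
    have hbs : IsSmall b := IsSmall.ext₁ _ hb hX (ha₃.isSmall hA)
    have hφ : ∃ φ : b ⟶ T.obj₁, i ≫ f = φ ≫ T.mor₁ ∧ δ ≫ φ⟦(1 : ℤ)⟧' = q ≫ T.mor₃ :=
      complete_distinguished_triangle_morphism₁ _ T hb hT f q hpq
    obtain ⟨φ, hφ₁, hφ₃⟩ := hφ
    obtain ⟨a₁, ha₁, k, l, hkl⟩ := h₁ hbs φ
    -- `e` is the extension of `a₃` by `a₁` obtained by pushing the triangle on `p` forward along
    -- `k`.
    obtain ⟨e, j, w, he⟩ := distinguished_cocone_triangle₂ (δ ≫ k⟦(1 : ℤ)⟧')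
    have hg : ∃ g : X ⟶ e, i ≫ g = k ≫ j ∧ p ≫ 𝟙 a₃ = g ≫ w :=
      complete_distinguished_triangle_morphism₂ _ _ hb he k (𝟙 a₃) (Category.id_comp _).symm
    obtain ⟨g, hg, -⟩ := hg
    have hl : (δ ≫ k⟦(1 : ℤ)⟧') ≫ l⟦(1 : ℤ)⟧' = q ≫ T.mor₃ := by
      rw [Category.assoc, ← Functor.map_comp, hkl, hφ₃]
    have hg' : ∃ g' : e ⟶ T.obj₂, j ≫ g' = l ≫ T.mor₁ ∧ w ≫ q = g' ≫ T.mor₂ :=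
      complete_distinguished_triangle_morphism₂ _ T he hT l q hl
    obtain ⟨g', hg', -⟩ := hg'
    -- Completions to morphisms of triangles are not unique, so `g ≫ g'` may differ from `f`. The
    -- error vanishes on the fibre `b` and thus factors through `a₃`, so `f` factors through `e ⊞
    -- a₃`.
    have hd : ∃ d : a₃ ⟶ T.obj₂, f - g ≫ g' = p ≫ d := Triangle.yoneda_exact₂ _ hb _ (by
      change i ≫ (f - g ≫ g') = 0
      rw [Preadditive.comp_sub, sub_eq_zero, hφ₁, ← Category.assoc, hg, Category.assoc, hg',
        ← Category.assoc, hkl])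
    obtain ⟨d, hd⟩ := hd
    have hf : f = g ≫ g' + p ≫ d := by
      rw [← sub_eq_iff_eq_add']
      exact hd
    rw [hf]
    exact FactorsThrough.add ⟨e, .ext _ he ha₁ ha₃, g, g', rfl⟩ ⟨a₃, ha₃, p, d, rfl⟩

/-- Factoring the identity of a compact object through a finitely built one exhibits it as a
retract. -/
lemma Built.finBuilt {X : C} (h : Built A X) (hA : ∀ Z, A Z → IsSmall Z) (hX : IsSmall X) :
    FinBuilt A X := by
  obtain ⟨Z, hZ, i, r, hir⟩ := h.factorsThrough hA hX (𝟙 X)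
  exact .retract ⟨i, r, hir⟩ hZ

end Built

/-! ### Comparison with the closures `gen`, `bigGen` and `bigCoprod`. -/

section Comparison

variable {C : Type u} [Category.{v} C] [HasZeroObject C] [HasShift C ℤ] [Preadditive C]
  [∀ n : ℤ, (shiftFunctor C n).Additive] [Pretriangulated C] {A : ObjectProperty C}

lemma split_distinguished {X Y Z : C} (k : X ⟶ Y) (p : Y ⟶ Z) (q : Y ⟶ X) (s : Z ⟶ Y)
    (hkq : k ≫ q = 𝟙 X) (hkp : k ≫ p = 0) (hsp : s ≫ p = 𝟙 Z) (hsq : s ≫ q = 0)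
    (hqk : q ≫ k + p ≫ s = 𝟙 Y) : Triangle.mk k p (0 : Z ⟶ X⟦(1 : ℤ)⟧) ∈ distTriang C := by
  let i : Y ≅ X ⊞ Z :=
    { hom := biprod.lift q p
      inv := biprod.desc k s
      hom_inv_id := by simpa using hqk
      inv_hom_id := by ext <;> simp [hkq, hkp, hsq, hsp] }
  refine isomorphic_distinguished _ (binaryBiproductTriangle_distinguished X Z) _
    (Triangle.isoMk _ _ (Iso.refl X) i (Iso.refl Z) ?_ ?_ ?_)
  · change k ≫ biprod.lift q p = 𝟙 X ≫ biprod.inl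
    ext <;> simp [hkq, hkp]
  · change p ≫ 𝟙 Z = biprod.lift q p ≫ biprod.snd
    simp
  · exact zero_comp.trans comp_zero.symm

lemma finBuilt_of_addClosure {X : C} (h : addClosure A X) : FinBuilt A X := by
  obtain ⟨n, hn⟩ := h
  let P : ObjectProperty C := FinBuilt A
  have hiso : P.IsClosedUnderIsomorphisms := ⟨fun e h => h.of_iso e⟩
  have hzero : P.ContainsZero := ⟨⟨_, isZero_zero C, .zero (isZero_zero C)⟩⟩
  have hbin : P.IsClosedUnderBinaryCoproducts := ⟨by
    rintro X ⟨p⟩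
    exact ((p.prop_diag_obj ⟨.left⟩).biprod (p.prop_diag_obj ⟨.right⟩)).of_iso
      (IsColimit.coconePointUniqueUpToIso (BinaryBiproduct.isColimit _ _)
        ((IsColimit.precomposeInvEquiv (diagramIsoPair p.diag) _).2 p.isColimit))⟩
  have := ObjectProperty.IsClosedUnderFiniteCoproducts.mk' (P := P)
  have h1 : A ≤ P := fun Y hY => .of hY
  exact P.colimitsOfShape_le _ _ (ObjectProperty.colimitsOfShape_monotone _ h1 _ hn)

lemma finBuilt_of_coprodN {n : ℕ} {X : C} (h : coprodN A n X) : FinBuilt A X := by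
  induction n using coprodN.induct generalizing X with
  | case1 => exact finBuilt_of_addClosure h
  | case2 => exact finBuilt_of_addClosure h
  | case3 n ih =>
    obtain ⟨Y, Z, f, g, k, hT, hY, hZ⟩ := h
    exact .ext _ hT (finBuilt_of_addClosure hY) (ih hZ)

lemma finBuilt_of_gen {G X : C} {I : Set ℤ} (h : gen G I X) : FinBuilt (shiftsIn G I) X := by
  obtain ⟨n, -, Y, hY, ⟨r⟩⟩ := h
  exact .retract r (finBuilt_of_coprodN hY)

lemma built_of_bigCoprod {X : C} (h : bigCoprod A X) : Built A X := by
  refine h (Built A) (fun Y hY => .of hY) (fun ι => ⟨?_⟩) ?_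
  · rintro Y ⟨p⟩
    let c : Cofan (fun i => p.diag.obj ⟨i⟩) := Cofan.mk Y fun i => p.ι.app ⟨i⟩
    have hc : IsColimit c := Cofan.IsColimit.mk _
      (fun t => p.isColimit.desc ⟨t.pt, Discrete.natTrans fun i => t.inj i.as⟩)
      (fun t j => p.isColimit.fac _ _)
      (fun t m hm => p.isColimit.uniq ⟨t.pt, Discrete.natTrans fun i => t.inj i.as⟩ m
        fun j => hm j.as)
    exact .coprod c hc fun i => p.prop_diag_obj ⟨i⟩
  · rintro Z ⟨X, Y, f, g, k, hT, hX, hY⟩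
    exact .ext _ hT hX hY

lemma built_of_bigGen {G X : C} {I : Set ℤ} (h : bigGen G I X) : Built (shiftsIn G I) X := by
  obtain ⟨Y, hY, ⟨r⟩⟩ := h
  exact .retract r (built_of_bigCoprod hY)

namespace bigCoprod

lemma of {X : C} (h : A X) : bigCoprod A X := fun _ hQ _ _ => hQ _ h

lemma colimit {ι : Type v} {F : Discrete ι ⥤ C} {c : Cocone F} (hc : IsColimit c)
    (h : ∀ i, bigCoprod A (F.obj i)) : bigCoprod A c.pt := fun Q h₁ h₂ h₃ =>
  have := h₂ ι
  Q.prop_of_isColimit hc fun i => h i Q h₁ h₂ h₃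

lemma ext {T : Triangle C} (hT : T ∈ distTriang C) (h₁ : bigCoprod A T.obj₁)
    (h₃ : bigCoprod A T.obj₃) : bigCoprod A T.obj₂ := fun Q hQ₁ hQ₂ hQ₃ =>
  hQ₃ _ ⟨_, _, _, _, _, hT, h₁ Q hQ₁ hQ₂ hQ₃, h₃ Q hQ₁ hQ₂ hQ₃⟩

lemma shift {X : C} (hX : bigCoprod A X) (n : ℤ) (hA : ∀ Y, A Y → bigCoprod A (Y⟦n⟧)) :
    bigCoprod A (X⟦n⟧) := by
  refine hX (fun X => bigCoprod A (X⟦n⟧)) hA (fun ι => ⟨?_⟩) ?_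
  · rintro Y ⟨p⟩
    exact colimit (isColimitOfPreserves (shiftFunctor C n) p.isColimit) p.prop_diag_obj
  · rintro Z ⟨X, Y, f, g, k, hT, hX, hY⟩
    exact ext (Triangle.shift_distinguished _ hT n) hX hY

section Swindle

variable [HasCoproducts.{v} C] {X Y : C}

/-- A retract of an object of `bigCoprod A` is a cone of an endomorphism of a countable
coproduct of copies of that object. -/
lemma retract (r : Retract X Y) (hA : ∀ Y, A Y → bigCoprod A (Y⟦(1 : ℤ)⟧)) (hY : bigCoprod A Y) :
    bigCoprod A X := by
  let Z : C := ∐ fun _ : ULift.{v} ℕ => Y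
  let ι (n : ℕ) : Y ⟶ Z := Sigma.ι (fun _ : ULift.{v} ℕ => Y) ⟨n⟩
  let desc {W : C} (f : ℕ → (Y ⟶ W)) : Z ⟶ W := Sigma.desc fun n => f n.down
  have ι_desc {W : C} (f : ℕ → (Y ⟶ W)) (n : ℕ) : ι n ≫ desc f = f n := by simp [ι, desc]
  have hext {W : C} {f g : Z ⟶ W} (h : ∀ n, ι n ≫ f = ι n ≫ g) : f = g :=
    Sigma.hom_ext _ _ fun n => h n.down
  let e : Y ⟶ Y := r.r ≫ r.i
  have he : e ≫ e = e := by simp [e]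
  have hei : r.i ≫ e = r.i := by simp [e]
  have her : e ≫ r.r = r.r := by simp [e]
  let k : Z ⟶ Z := desc fun n => (𝟙 Y - e) ≫ ι n + e ≫ ι (n + 1)
  let p : Z ⟶ X := desc fun n => if n = 0 then r.r else 0
  let q : Z ⟶ Z := desc fun n => (𝟙 Y - e) ≫ ι n + if n = 0 then 0 else e ≫ ι (n - 1)
  let s : X ⟶ Z := r.i ≫ ι 0
  have hk (n : ℕ) : ι n ≫ k = (𝟙 Y - e) ≫ ι n + e ≫ ι (n + 1) :=
    ι_desc (fun n => (𝟙 Y - e) ≫ ι n + e ≫ ι (n + 1)) n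
  have hp0 : ι 0 ≫ p = r.r := ι_desc (fun n => if n = 0 then r.r else 0) 0
  have hp (n : ℕ) : ι (n + 1) ≫ p = 0 := ι_desc (fun n => if n = 0 then r.r else 0) (n + 1)
  have hq0 : ι 0 ≫ q = (𝟙 Y - e) ≫ ι 0 :=
    (ι_desc (fun n => (𝟙 Y - e) ≫ ι n + if n = 0 then 0 else e ≫ ι (n - 1)) 0).trans (by simp)
  have hq (n : ℕ) : ι (n + 1) ≫ q = (𝟙 Y - e) ≫ ι (n + 1) + e ≫ ι n :=
    (ι_desc (fun n => (𝟙 Y - e) ≫ ι n + if n = 0 then 0 else e ≫ ι (n - 1)) (n + 1)).trans (by simp)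
  have hkq : k ≫ q = 𝟙 Z := hext fun n => by
    rw [← Category.assoc, hk, Preadditive.add_comp, Category.assoc, Category.assoc, hq]
    rcases n with - | n
    · rw [hq0]
      simp only [Preadditive.sub_comp, Preadditive.comp_sub, Preadditive.comp_add,
        Category.id_comp, Category.comp_id, reassoc_of% he]
      abel
    · rw [hq]
      simp only [Preadditive.sub_comp, Preadditive.comp_sub, Preadditive.comp_add,
        Category.id_comp, Category.comp_id, reassoc_of% he]
      abel
  have hkp : k ≫ p = 0 := hext fun n => by
    rw [← Category.assoc, hk, Preadditive.add_comp, Category.assoc, Category.assoc, hp]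
    rcases n with - | n
    · simp [hp0, Preadditive.sub_comp, her]
    · simp [hp]
  have hsp : s ≫ p = 𝟙 X := by simp [s, hp0]
  have hsq : s ≫ q = 0 := by
    simp only [s, Category.assoc, hq0, Preadditive.sub_comp, Preadditive.comp_sub,
      Category.id_comp, reassoc_of% hei, sub_self]
  have hqk : q ≫ k + p ≫ s = 𝟙 Z := hext fun n => by
    rcases n with - | n
    · rw [Preadditive.comp_add, ← Category.assoc, ← Category.assoc, hq0, hp0]
      simp only [Category.assoc, hk, Preadditive.sub_comp, Preadditive.comp_sub,
        Preadditive.comp_add, Category.id_comp, Category.comp_id, s, e,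
        r.retract_assoc]
      abel
    · rw [Preadditive.comp_add, ← Category.assoc, ← Category.assoc, hq, hp]
      simp only [Category.assoc, hk, Preadditive.sub_comp, Preadditive.comp_sub,
        Preadditive.comp_add, Preadditive.add_comp, zero_comp, Category.id_comp,
        Category.comp_id, reassoc_of% he]
      abel
  have hT := split_distinguished k p q s hkq hkp hsp hsq hqk
  have hZ : bigCoprod A Z := colimit (colimit.isColimit _) fun _ => hY
  exact ext (rot_of_distTriang _ hT) hZ (hZ.shift 1 hA)

end Swindle

end bigCoprod

/-- Stability of `A` under the shift by 1 makes `bigCoprod A` closed under retracts, so allowing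
retracts in `Built` adds nothing. This applies to the aisle, where `I` is a lower ray. -/
lemma bigCoprod_of_built [HasCoproducts.{v} C] {X : C} (h : Built A X)
    (hA : ∀ Y, A Y → A (Y⟦(1 : ℤ)⟧)) : bigCoprod A X := by
  induction h with
  | of h => exact bigCoprod.of h
  | coprod c hc _ h => exact bigCoprod.colimit hc fun i => h i.as
  | retract r _ h => exact bigCoprod.retract r (fun Y hY => bigCoprod.of (hA Y hY)) h
  | ext T hT _ _ h₁ h₃ => exact bigCoprod.ext hT h₁ h₃

end Comparison

/-! ### The t-structure generated by `G`, and integer forms of boundedness and dimension. -/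

section Generator

variable {C : Type u} [Category.{v} C] [HasZeroObject C] [HasShift C ℤ] [Preadditive C]
  [∀ n : ℤ, (shiftFunctor C n).Additive] [Pretriangulated C] {G : C}

lemma shiftsIn_shift {I J : Set ℤ} {X : C} (h : shiftsIn G I X) (n : ℤ)
    (hIJ : ∀ i ∈ I, i - n ∈ J) : shiftsIn G J (X⟦n⟧) := by
  obtain ⟨i, hi, ⟨e⟩⟩ := h
  exact ⟨i - n, hIJ i hi, ⟨(shiftFunctor C n).mapIso e ≪≫
    ((shiftFunctorAdd' C (-i) n (-(i - n)) (by lia)).app G).symm⟩⟩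

lemma shiftsIn_mono {I J : Set ℤ} (h : I ⊆ J) {X : C} (hX : shiftsIn G I X) :
    shiftsIn G J X := by
  obtain ⟨i, hi, e⟩ := hX
  exact ⟨i, h hi, e⟩

lemma shiftsIn_zero {I : Set ℤ} (h : (0 : ℤ) ∈ I) : shiftsIn G I G :=
  ⟨0, h, ⟨((shiftFunctorZero' C (-0 : ℤ) (by simp)).app G).symm⟩⟩

lemma isSmall_of_shiftsIn (hG : IsSmall G) {I : Set ℤ} {X : C} (h : shiftsIn G I X) :
    IsSmall X := by
  obtain ⟨i, -, ⟨e⟩⟩ := h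
  exact (hG.shift (-i)).of_retract e.retract

/-- The objects built from the shifts `G⟦-i⟧` with `i ∈ I`. -/
abbrev BuiltIn (G : C) (I : Set ℤ) : ObjectProperty C := Built (shiftsIn G I)

/-- The objects finitely built from the shifts `G⟦-i⟧` with `i ∈ I`. -/
abbrev FinBuiltIn (G : C) (I : Set ℤ) : ObjectProperty C := FinBuilt (shiftsIn G I)

lemma BuiltIn.mono {I J : Set ℤ} (h : I ⊆ J) {X : C} (hX : BuiltIn G I X) : BuiltIn G J X :=
  hX.trans fun _ hY => .of (shiftsIn_mono h hY)

lemma FinBuiltIn.built {I : Set ℤ} {X : C} (h : FinBuiltIn G I X) : BuiltIn G I X :=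
  FinBuilt.built h

lemma FinBuiltIn.mono {I J : Set ℤ} (h : I ⊆ J) {X : C} (hX : FinBuiltIn G I X) :
    FinBuiltIn G J X :=
  FinBuilt.trans hX fun _ hY => .of (shiftsIn_mono h hY)

lemma BuiltIn.shift {I J : Set ℤ} {X : C} (hX : BuiltIn G I X) (n : ℤ)
    (hIJ : ∀ i ∈ I, i - n ∈ J) : BuiltIn G J (X⟦n⟧) :=
  Built.shift hX n fun _ hY => .of (shiftsIn_shift hY n hIJ)

lemma FinBuiltIn.shift {I J : Set ℤ} {X : C} (hX : FinBuiltIn G I X) (n : ℤ)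
    (hIJ : ∀ i ∈ I, i - n ∈ J) : FinBuiltIn G J (X⟦n⟧) :=
  FinBuilt.shift hX n fun _ hY => .of (shiftsIn_shift hY n hIJ)

lemma FinBuiltIn.exists_Icc {X : C} (h : FinBuiltIn G Set.univ X) :
    ∃ b : ℕ, FinBuiltIn G (Set.Icc (-b : ℤ) b) X := by
  induction h with
  | of h =>
    obtain ⟨i, -, e⟩ := h
    exact ⟨i.natAbs, .of ⟨i, ⟨by lia, by lia⟩, e⟩⟩
  | zero h => exact ⟨0, .zero h⟩
  | retract r _ h =>
    obtain ⟨b, hb⟩ := h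
    exact ⟨b, .retract r hb⟩
  | ext T hT _ _ h₁ h₃ =>
    obtain ⟨b, hb⟩ := h₁
    obtain ⟨c, hc⟩ := h₃
    exact ⟨b + c, .ext T hT
      (FinBuiltIn.mono (Set.Icc_subset_Icc (by push_cast; lia) (by push_cast; lia)) hb)
      (FinBuiltIn.mono (Set.Icc_subset_Icc (by push_cast; lia) (by push_cast; lia)) hc)⟩

/-- The objects built from `G⟦-i⟧` with `i ≤ n`: the aisle generated by `G`, shifted. -/
abbrev AisleLE (G : C) (n : ℤ) : ObjectProperty C := BuiltIn G (Set.Iic n)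

/-- The objects that receive only zero maps from `G⟦-i⟧` with `i < n`: the coaisle of the
t-structure generated by `G`, shifted. -/
def AisleGE (G : C) (n : ℤ) : ObjectProperty C := fun X => ∀ i < n, HomZero (G⟦-i⟧) X

lemma AisleLE.mono {m n : ℤ} (h : m ≤ n) {X : C} (hX : AisleLE G m X) : AisleLE G n X :=
  BuiltIn.mono (Set.Iic_subset_Iic.2 h) hX

lemma AisleGE.mono {m n : ℤ} (h : m ≤ n) {X : C} (hX : AisleGE G n X) : AisleGE G m X :=
  fun i hi => hX i (hi.trans_le h)

lemma AisleLE.shift {n : ℤ} {X : C} (hX : AisleLE G n X) (a m : ℤ) (h : m + a = n) :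
    AisleLE G m (X⟦a⟧) :=
  BuiltIn.shift hX a fun i (hi : i ≤ n) => show i - a ≤ m by lia

lemma homZero_shift_add_iff {X Y : C} (a b c : ℤ) (h : a + b = c) :
    HomZero ((X⟦a⟧)⟦b⟧) Y ↔ HomZero (X⟦c⟧) Y := by
  let e : X⟦c⟧ ≅ (X⟦a⟧)⟦b⟧ := (shiftFunctorAdd' C a b c h).app X
  exact ⟨fun h => h.of_iso_left e.symm, fun h => h.of_iso_left e⟩

lemma homZero_generator_shift_iff {X Y : C} (i a j : ℤ) (h : i + a = j) :
    HomZero (X⟦-i⟧) (Y⟦a⟧) ↔ HomZero (X⟦-j⟧) Y := by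
  rw [← homZero_shift_left_iff _ _ (-a) a (by lia), homZero_shift_add_iff _ _ (-j) (by lia)]

lemma AisleGE.shift {n : ℤ} {X : C} (hX : AisleGE G n X) (a m : ℤ) (h : m + a = n) :
    AisleGE G m (X⟦a⟧) := fun i hi =>
  (homZero_generator_shift_iff i a (i + a) rfl).2 (hX _ (by lia))

lemma shiftNegIso (X : C) (n : ℤ) : Nonempty ((X⟦n⟧)⟦-n⟧ ≅ X) :=
  ⟨(shiftFunctorCompIsoId C n (-n) (by lia)).app X⟩

lemma AisleGE.of_iso {n : ℤ} {X Y : C} (e : X ≅ Y) (h : AisleGE G n X) : AisleGE G n Y :=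
  fun i hi => (h i hi).of_iso_right e

lemma aisleLE_shift_iff {X : C} (n a m : ℤ) (h : m + a = n) :
    AisleLE G m (X⟦a⟧) ↔ AisleLE G n X :=
  ⟨fun hX => (hX.shift (-a) n (by lia)).of_iso (shiftNegIso X a).some, fun hX => hX.shift a m h⟩

lemma aisleGE_shift_iff {X : C} (n a m : ℤ) (h : m + a = n) :
    AisleGE G m (X⟦a⟧) ↔ AisleGE G n X :=
  ⟨fun hX => (hX.shift (-a) n (by lia)).of_iso (shiftNegIso X a).some, fun hX => hX.shift a m h⟩

lemma tLE_iff [HasCoproducts.{v} C] {n : ℤ} {X : C} : tLE G n X ↔ AisleLE G n X := by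
  rw [← aisleLE_shift_iff n n 0 (by lia)]
  exact ⟨fun h => built_of_bigCoprod h, fun h => bigCoprod_of_built h fun Y hY =>
    shiftsIn_shift hY 1 fun i (hi : i ≤ 0) => show i - 1 ≤ 0 by lia⟩

lemma tGE_iff {n : ℤ} {X : C} : tGE G n X ↔ AisleGE G n X := by
  rw [← aisleGE_shift_iff n (n - 1) 1 (by lia)]
  refine ⟨fun h i hi f => h f ⟨i, show i ≤ 0 by lia, ⟨Iso.refl _⟩⟩, ?_⟩
  rintro h Y f ⟨i, hi, ⟨e⟩⟩
  exact (h i (show i < 1 from Int.lt_add_one_iff.2 hi)).of_iso_left e.symm f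

/-- Boundedness with respect to the t-structure generated by `G`. -/
def AisleBounded (G : C) : ObjectProperty C :=
  fun X => (∃ n, AisleLE G n X) ∧ ∃ n, AisleGE G n X

lemma isBoundedObj_iff [HasCoproducts.{v} C] {X : C} :
    IsBoundedObj G X ↔ AisleBounded G X := by
  simp only [IsBoundedObj, tLE_iff, tGE_iff]
  constructor
  · rintro ⟨n, h, h'⟩
    exact ⟨⟨n, (aisleLE_shift_iff _ _ _ (by lia)).1 h⟩,
      ⟨1 - n, (aisleGE_shift_iff _ _ _ (by lia)).1 h'⟩⟩
  · rintro ⟨⟨n, h⟩, ⟨m, h'⟩⟩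
    refine ⟨n.natAbs + m.natAbs + 1, (aisleLE_shift_iff _ _ _ rfl).2 (h.mono (by lia)),
      (aisleGE_shift_iff _ _ _ rfl).2 (h'.mono (by lia))⟩

lemma AisleBounded.shift {X : C} (h : AisleBounded G X) (a : ℤ) : AisleBounded G (X⟦a⟧) := by
  obtain ⟨⟨n, h⟩, ⟨m, h'⟩⟩ := h
  exact ⟨⟨n - a, h.shift _ _ (by lia)⟩, ⟨m - a, h'.shift _ _ (by lia)⟩⟩

/-- `X` admits only zero maps to the bounded objects of the aisle in degrees `< -n`. -/
def ProjDimLE (G X : C) (n : ℤ) : Prop :=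
  ∀ Y : C, AisleBounded G Y → AisleLE G (-n - 1) Y → HomZero X Y

lemma ProjDimLE.mono {X : C} {m n : ℤ} (h : m ≤ n) (hX : ProjDimLE G X m) :
    ProjDimLE G X n :=
  fun Y hY hY' => hX Y hY (AisleLE.mono (by lia) hY')

lemma projDimLE_iff [HasCoproducts.{v} C] {X : C} {n : ℤ} :
    ProjDimLE G X n ↔ ∀ (i : ℤ) (Y : C), n < i → IsBoundedObj G Y → tLE G 0 Y →
      ∀ f : X ⟶ Y⟦i⟧, f = 0 := by
  simp only [isBoundedObj_iff, tLE_iff]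
  refine ⟨fun h i Y hi hY hY' => h _ (hY.shift _)
    ((hY'.mono (show 0 ≤ -n - 1 + i by lia)).shift i _ rfl), ?_⟩
  intro h Y hY hY'
  have := h (n + 1) (Y⟦-(n + 1)⟧) (by lia) (hY.shift _) (hY'.shift _ _ (by lia))
  exact HomZero.of_iso_right this ((shiftFunctorCompIsoId C (-(n + 1)) (n + 1) (by lia)).app Y)

/-- An integral upper bound for the finitistic dimension. -/
def FinDimLE (G : C) (p : ℤ) : Prop :=
  ∀ X : C, IsSmall X → AisleBounded G X → AisleGE G 0 X → ProjDimLE G X p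

lemma FinDimLE.mono {p q : ℤ} (hpq : p ≤ q) (h : FinDimLE G p) : FinDimLE G q :=
  fun X h₁ h₂ h₃ => (h X h₁ h₂ h₃).mono hpq

lemma FinDimLE.projDimLE {p : ℤ} (h : FinDimLE G p) {X : C} (hX : IsSmall X)
    (hb : AisleBounded G X) (e : ℤ) (he : AisleGE G (-e) X) : ProjDimLE G X (p + e) :=
  fun _ hY hY' => (homZero_shift_iff X _ (-e)).1
    ((h _ (hX.shift (-e)) (hb.shift _) (he.shift _ _ (by lia))) _ (hY.shift _)
      (hY'.shift _ _ (by lia)))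

end Generator

/-! ### Hom-vanishing between objects built from shifts of the generator. -/

section Vanishing

variable {C : Type u} [Category.{v} C] [HasZeroObject C] [HasShift C ℤ] [Preadditive C]
  [∀ n : ℤ, (shiftFunctor C n).Additive] [Pretriangulated C] {G : C}

/-- There are no nonzero maps `G ⟶ G⟦i⟧` with `i > c`. -/
def SelfExtLE (G : C) (c : ℤ) : Prop := ∀ i > c, HomZero G (G⟦i⟧)

/-- There are no nonzero maps `G⟦i⟧ ⟶ G` with `i > b`. -/
def SelfCoextLE (G : C) (b : ℤ) : Prop := ∀ i > b, HomZero (G⟦i⟧) G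

lemma homZero_shift_shift_iff {X Y : C} (a b c : ℤ) (h : a + c = b) :
    HomZero (X⟦a⟧) (Y⟦b⟧) ↔ HomZero X (Y⟦c⟧) := by
  rw [← homZero_shift_iff X _ a]
  let e : Y⟦b⟧ ≅ (Y⟦c⟧)⟦a⟧ := (shiftFunctorAdd' C c a b (by lia)).app Y
  exact ⟨fun h => h.of_iso_right e, fun h => h.of_iso_right e.symm⟩

lemma homZero_shift_shift_iff' {X Y : C} (a b c : ℤ) (h : b + c = a) :
    HomZero (X⟦a⟧) (Y⟦b⟧) ↔ HomZero (X⟦c⟧) Y := by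
  rw [← homZero_shift_iff _ Y b]
  let e : X⟦a⟧ ≅ (X⟦c⟧)⟦b⟧ := (shiftFunctorAdd' C c b a (by lia)).app X
  exact ⟨fun h => h.of_iso_left e, fun h => h.of_iso_left e.symm⟩

/-- On generators this is `Hom(G⟦-i⟧, G⟦-j⟧) = Hom(G, G⟦i - j⟧)` with `i - j ≥ k - m > c`.
Compactness of `G` carries it to all of the aisle. -/
lemma SelfExtLE.homZero (hG : IsSmall G) {c : ℤ} (hc : SelfExtLE G c) {k m : ℤ}
    (hkm : m + c < k) {X Y : C} (hX : BuiltIn G (Set.Ici k) X) (hY : AisleLE G m Y) :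
    HomZero X Y := by
  refine Built.homZero_left hX ?_
  rintro _ ⟨i, hi, ⟨e⟩⟩
  refine HomZero.of_iso_left (Built.homZero_right hY (hG.shift _) ?_) e.symm
  rintro _ ⟨j, hj, ⟨e'⟩⟩
  refine HomZero.of_iso_right ?_ e'.symm
  rw [homZero_shift_shift_iff _ _ (i - j) (by lia)]
  simp only [Set.mem_Ici, Set.mem_Iic] at hi hj
  exact hc _ (by lia)

lemma SelfCoextLE.aisleGE (hG : IsSmall G) {b : ℤ} (hb : SelfCoextLE G b) {k : ℤ} {X : C}
    (hX : BuiltIn G (Set.Ici k) X) : AisleGE G (k - b) X := by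
  intro i hi
  refine Built.homZero_right hX (hG.shift _) ?_
  rintro _ ⟨j, hj, ⟨e⟩⟩
  refine HomZero.of_iso_right ?_ e.symm
  rw [homZero_shift_shift_iff' _ _ (j - i) (by lia)]
  simp only [Set.mem_Ici] at hj
  exact hb _ (by lia)

lemma homZero_of_forall_generator {I : Set ℤ} {X Y : C} (hX : BuiltIn G I X)
    (h : ∀ i ∈ I, HomZero (G⟦-i⟧) Y) : HomZero X Y := by
  refine Built.homZero_left hX ?_
  rintro _ ⟨i, hi, ⟨e⟩⟩
  exact (h i hi).of_iso_left e.symm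

lemma IsBoundedGen.exists_selfCoextLE (h : IsBoundedGen G) : ∃ b : ℤ, SelfCoextLE G b := by
  obtain ⟨N, hN⟩ := h
  exact ⟨-N, fun i hi => (homZero_shift_left_iff G G i (-i) (by lia)).2 (hN (-i) (by lia))⟩

/-- A finite construction involves only finitely many shifts, whence a bounded interval. -/
lemma IsCompactGenerator.finBuiltIn (hG : IsCompactGenerator G) {X : C} (hX : IsSmall X) :
    ∃ b : ℕ, FinBuiltIn G (Set.Icc (-b : ℤ) b) X :=
  FinBuiltIn.exists_Icc ((built_of_bigGen (hG.2 X)).finBuilt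
    (fun _ hY => isSmall_of_shiftsIn hG.1.isSmall hY) hX)

lemma IsCompactGenerator.exists_aisleLE (hG : IsCompactGenerator G) {X : C} (hX : IsSmall X) :
    ∃ n, AisleLE G n X := by
  obtain ⟨b, hb⟩ := hG.finBuiltIn hX
  exact ⟨b, hb.built.mono Set.Icc_subset_Iic_self⟩

lemma IsCompactGenerator.aisleBounded (hG : IsCompactGenerator G) {b : ℤ}
    (hb : SelfCoextLE G b) {X : C} (hX : IsSmall X) : AisleBounded G X := by
  obtain ⟨n, hn⟩ := hG.finBuiltIn hX
  exact ⟨⟨n, hn.built.mono Set.Icc_subset_Iic_self⟩,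
    ⟨_, hb.aisleGE hG.1.isSmall (hn.built.mono Set.Icc_subset_Ici_self)⟩⟩

end Vanishing

/-! ### Approximation by boundedly many shifts of the generator. -/

section Approximation

variable {C : Type u} [Category.{v} C] [HasZeroObject C] [HasShift C ℤ] [Preadditive C]
  [∀ n : ℤ, (shiftFunctor C n).Additive] [Pretriangulated C] {G : C}

/-- A family of subcategories compatible with shifts whose objects can be approximated by objects
built from boundedly many shifts of `G`. -/
structure IsApproximating (G : C) (L : ℤ → ObjectProperty C) (a : ℤ) : Prop where
  shift {n : ℤ} {X : C} (h : L n X) (k m : ℤ) (hm : m + k = n) : L m (X⟦k⟧)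
  approx_zero (M : C) (h : L 0 M) :
    ObjectProperty.extensionProduct (BuiltIn G (Set.Icc (-a) a)) (L (-1)) M

namespace IsApproximating

variable {L : ℤ → ObjectProperty C} {a : ℤ} (h : IsApproximating G L a)
include h

lemma approx {n : ℤ} {M : C} (hM : L n M) :
    ObjectProperty.extensionProduct (BuiltIn G (Set.Icc (n - a) (n + a))) (L (n - 1)) M := by
  obtain ⟨E, D, f, g, w, hT, hE, hD⟩ := h.approx_zero _ (h.shift hM n 0 (by lia))
  refine ObjectProperty.prop_of_iso _ (shiftNegIso M n).some
    ⟨_, _, _, _, _, Triangle.shift_distinguished _ hT (-n), hE.shift (-n) ?_,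
      h.shift hD (-n) _ (by lia)⟩
  rintro i ⟨h₁, h₂⟩
  exact ⟨by lia, by lia⟩

/-- Associativity of `extensionProduct`, which rests on the octahedral axiom, merges successive
approximations into one. -/
lemma approx_iterate [IsTriangulated C] (k : ℕ) {n : ℤ} {M : C} (hM : L n M) :
    ObjectProperty.extensionProduct (BuiltIn G (Set.Icc (n - k - a) (n + a)))
      (L (n - k - 1)) M := by
  induction k with
  | zero => simpa using h.approx hM
  | succ k ih =>
    have h₁ : L (n - k - 1) ≤ ObjectProperty.extensionProduct
        (BuiltIn G (Set.Icc (n - k - 1 - a) (n - k - 1 + a))) (L (n - k - 1 - 1)) :=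
      fun Y hY => h.approx hY
    have h₂ := ObjectProperty.monotone_extensionProduct_right _ h₁ _ ih
    rw [← ObjectProperty.extensionProduct_assoc] at h₂
    have h₃ : n - ((k + 1 : ℕ) : ℤ) = n - k - 1 := by push_cast; ring
    rw [h₃]
    refine ObjectProperty.monotone_extensionProduct_left _ ?_ _ h₂
    rintro Z ⟨X, Y, f, g, w, hT, hX, hY⟩
    exact .ext _ hT (BuiltIn.mono (Set.Icc_subset_Icc (by lia) le_rfl) hX)
      (BuiltIn.mono (Set.Icc_subset_Icc le_rfl (by lia)) hY)

end IsApproximating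

/-- Compact objects of projective dimension at most `p` are finitely built from the `G⟦-i⟧` with
`i ≥ -p - a`. -/
def ApproxBound (G : C) (a : ℤ) : Prop :=
  ∀ (X : C) (p : ℤ), IsSmall X → ProjDimLE G X p → FinBuiltIn G (Set.Ici (-p - a)) X

lemma retract_of_comp_eq_zero {X Y Z : C} {f : X ⟶ Y} {g : Y ⟶ Z} {w : Z ⟶ X⟦(1 : ℤ)⟧}
    (hT : Triangle.mk f g w ∈ distTriang C) (hg : g = 0) : Nonempty (Retract Y X) := by
  have : ∃ s : Y ⟶ X, 𝟙 Y = s ≫ f :=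
    Triangle.coyoneda_exact₂ _ hT (𝟙 Y) (show 𝟙 Y ≫ g = 0 by rw [hg, comp_zero])
  obtain ⟨s, hs⟩ := this
  exact ⟨⟨s, f, hs.symm⟩⟩

lemma retract_of_comp_eq_zero' {X Y Z : C} {f : X ⟶ Y} {g : Y ⟶ Z} {w : Z ⟶ X⟦(1 : ℤ)⟧}
    (hT : Triangle.mk f g w ∈ distTriang C) (hf : f = 0) : Nonempty (Retract Y Z) := by
  have : ∃ s : Z ⟶ Y, 𝟙 Y = g ≫ s :=
    Triangle.yoneda_exact₂ _ hT (𝟙 Y) (show f ≫ 𝟙 Y = 0 by rw [hf, zero_comp])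
  obtain ⟨s, hs⟩ := this
  exact ⟨⟨g, s, hs.symm⟩⟩

lemma IsApproximating.approxBound [IsTriangulated C] {a : ℤ}
    (h : IsApproximating G (AisleLE G) a) (hG : IsCompactGenerator G) {b : ℤ}
    (hb : SelfCoextLE G b) : ApproxBound G a := by
  intro X p hX hp
  obtain ⟨⟨m, hm⟩, l, hl⟩ := hG.aisleBounded hb hX
  let k : ℕ := (m + p).natAbs
  obtain ⟨E, D, f, g, w, hT, hE, hD⟩ := h.approx_iterate k
    (hm.mono (show m ≤ k - p by lia))
  have hE' := hb.aisleGE hG.1.isSmall (hE.mono Set.Icc_subset_Ici_self)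
  -- `D` is an extension of `E⟦1⟧` by `X`, both bounded below. Hence `D` is bounded, the bound on
  -- projective dimension kills `X ⟶ D`, and `X` is a retract of `E`.
  have hD' : AisleGE G (min l ((k - p - k - a) - b - 1)) D := fun i hi =>
    HomZero.ext_right _ (rot_of_distTriang _ hT) (hl i (by lia))
      (hE'.shift 1 _ (sub_add_cancel _ 1) i (by lia))
  obtain ⟨r⟩ := retract_of_comp_eq_zero hT
    (hp D ⟨⟨_, hD⟩, ⟨_, hD'⟩⟩ (AisleLE.mono (by lia) hD) g)
  refine Built.finBuilt (.retract r (hE.mono fun i hi => ?_))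
    (fun _ hY => isSmall_of_shiftsIn hG.1.isSmall hY) hX
  have := hi.1
  simp only [Set.mem_Ici]
  lia

/-- Here `D` need not lie in the aisle of `G`, so it is approximated a second time: maps from `X` to
`E'` vanish by projective dimension, and maps to `D'` because `D'` is deep in `L`. The upper end of
`E'` exceeds the level of `D` by `a`, which is why the constant doubles. -/
lemma IsApproximating.approxBound_of_homZero [IsTriangulated C] {L : ℤ → ObjectProperty C} {a : ℤ}
    (h : IsApproximating G L a) (hL : ∀ X, IsSmall X → ∃ n, L n X)
    (hLmono : ∀ {m n : ℤ} (_ : m ≤ n) {X : C}, L m X → L n X)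
    (hL' : ∀ X, IsSmall X → ∃ n, ∀ Y, L n Y → HomZero X Y) (hG : IsCompactGenerator G) {b : ℤ}
    (hb : SelfCoextLE G b) : ApproxBound G (2 * a) := by
  intro X p hX hp
  obtain ⟨m, hm⟩ := hL X hX
  obtain ⟨n, hn⟩ := hL' X hX
  let k : ℕ := (m + a + p).natAbs
  obtain ⟨E, D, f, g, w, hT, hE, hD⟩ := h.approx_iterate k
    (hLmono (show m ≤ k - a - p by lia) hm)
  obtain ⟨E', D', f', g', w', hT', hE', hD'⟩ := h.approx_iterate (p + a + n).natAbs hD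
  have hXE' : HomZero X E' := hp E'
    ⟨⟨_, hE'.mono Set.Icc_subset_Iic_self⟩,
      ⟨_, hb.aisleGE hG.1.isSmall (hE'.mono Set.Icc_subset_Ici_self)⟩⟩
    (hE'.mono fun i hi => show i ≤ -p - 1 by have := hi.2; lia)
  have hXD' : HomZero X D' := hn _ (hLmono (by lia) hD')
  obtain ⟨r⟩ := retract_of_comp_eq_zero hT (HomZero.ext_right _ hT' hXE' hXD' g)
  refine Built.finBuilt (.retract r (hE.mono fun i hi => ?_))
    (fun _ hY => isSmall_of_shiftsIn hG.1.isSmall hY) hX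
  have := hi.1
  simp only [Set.mem_Ici]
  lia

/-- A bounded above object is as far in the aisle as its vanishing allows, up to the
approximation constant. -/
lemma IsApproximating.aisleLE {a : ℤ} (h : IsApproximating G (AisleLE G) a) {n u : ℤ} {M : C}
    (hM : AisleLE G n M) (hu : ∀ i > u, HomZero (G⟦-i⟧) M) : AisleLE G (u + a) M := by
  suffices ∀ k : ℕ, AisleLE G (u + a + k) M → AisleLE G (u + a) M from
    this (n - (u + a)).natAbs (hM.mono (by lia))
  intro k
  induction k with
  | zero => simp
  | succ k ih =>
    intro hk
    obtain ⟨E, D, f, g, w, hT, hE, hD⟩ := h.approx hk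
    -- `E` is built from `G⟦-i⟧` with `i ≥ u + k + 1`, so `E ⟶ M` is zero and `M` is a retract of
    -- `D`, one step lower in the aisle.
    obtain ⟨r⟩ := retract_of_comp_eq_zero' hT
      (homZero_of_forall_generator hE (fun i hi => hu i (by have := hi.1; push_cast at this; lia)) f)
    exact ih (AisleLE.mono (by push_cast; lia) (.retract r hD))

end Approximation

/-! ### Consequences of weak approximability for an arbitrary compact generator. -/

section WeaklyApproximable

variable {C : Type u} [Category.{v} C] [HasZeroObject C] [HasShift C ℤ] [Preadditive C]
  [∀ n : ℤ, (shiftFunctor C n).Additive] [Pretriangulated C] [IsTriangulated C] {G : C}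

lemma Built.le_tStructure (t : Triangulated.TStructure C) {A : ObjectProperty C} {n : ℤ} {X : C}
    (h : Built A X) (hA : ∀ Y, A Y → t.le n Y) : t.le n X := by
  rw [t.le_iff_isLE, t.isLE_iff_orthogonal n (n + 1) rfl]
  intro Y f hY
  exact Built.homZero_left h (fun Z hZ g => by
    have := (t.le_iff_isLE _ _).1 (hA Z hZ)
    exact t.zero g n (n + 1)) f

/-- The given t-structure comes with some compact generator `H`, which is finitely built from shifts
of `G` in `[-b, b]`; replacing `H` by `G` costs `b`. Keeping `t.le` as `L` avoids comparing it with
the aisle generated by `G`. -/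
lemma IsWeaklyApproximable.exists_isApproximating (hC : IsWeaklyApproximable C)
    (hG : IsCompactGenerator G) : ∃ (L : ℤ → ObjectProperty C) (a : ℤ),
      IsApproximating G L a ∧ (∀ X, IsSmall X → ∃ n, L n X) ∧
      (∀ {m n : ℤ} (_ : m ≤ n) {X : C}, L m X → L n X) ∧
      ∀ X, IsSmall X → ∃ n, ∀ Y, L n Y → HomZero X Y := by
  obtain ⟨H, t, A, hA, hH, hHA, hAH, happ⟩ := hC
  have hshift {n : ℤ} {X : C} (h : t.le n X) (k m : ℤ) (hm : m + k = n) : t.le m (X⟦k⟧) :=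
    t.le_shift n k m (by lia) X h
  obtain ⟨b, hb⟩ := hG.finBuiltIn hH.1.isSmall
  refine ⟨t.le, A + b, ⟨hshift, fun M hM => ?_⟩, fun X hX => ?_, fun h X hX => ?_,
    fun X hX => ?_⟩
  · obtain ⟨E, D, f, g, w, hT, hE, hD⟩ := happ M hM
    refine ⟨E, D, f, g, w, hT, (built_of_bigGen hE).trans ?_, hD⟩
    rintro _ ⟨i, ⟨h₁, h₂⟩, ⟨e⟩⟩
    refine Built.of_iso e.symm (BuiltIn.shift hb.built (-i) ?_)
    rintro j ⟨h₃, h₄⟩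
    exact ⟨by lia, by lia⟩
  · obtain ⟨c, hc⟩ := hH.finBuiltIn hX
    refine ⟨A + c, hc.built.le_tStructure t ?_⟩
    rintro _ ⟨i, ⟨h₁, h₂⟩, ⟨e⟩⟩
    refine (t.le _).prop_of_iso e.symm (t.le_monotone (show A + i ≤ A + c by lia) _ ?_)
    have := hshift hHA (-i - A) (A + i) (by lia)
    exact (t.le _).prop_of_iso ((shiftFunctorAdd' C A (-i - A) (-i) (by lia)).app H).symm this
  · exact t.le_monotone h X hX
  · obtain ⟨c, hc⟩ := hH.finBuiltIn hX
    refine ⟨-A - c, fun Y hY => homZero_of_forall_generator hc.built fun i hi => ?_⟩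
    have h0 : t.le 0 (Y⟦i - A⟧) := t.le_monotone (show -A - c - (i - A) ≤ 0 by
      have := hi.1; lia) _ (hshift hY (i - A) _ (by lia))
    exact (homZero_generator_shift_iff A (i - A) i (by lia)).1 (hAH _ h0)

lemma IsWeaklyApproximable.exists_selfExtLE (hC : IsWeaklyApproximable C)
    (hG : IsCompactGenerator G) : ∃ c, SelfExtLE G c := by
  obtain ⟨L, a, h, hL, hmono, hL'⟩ := hC.exists_isApproximating hG
  obtain ⟨m, hm⟩ := hL G hG.1.isSmall
  obtain ⟨n, hn⟩ := hL' G hG.1.isSmall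
  exact ⟨m - n, fun i hi => hn _ (hmono (show m - i ≤ n by lia) (h.shift hm i _ (by lia)))⟩

lemma IsWeaklyApproximable.exists_approxBound (hC : IsWeaklyApproximable C)
    (hG : IsCompactGenerator G) {b : ℤ} (hb : SelfCoextLE G b) : ∃ a, ApproxBound G a := by
  obtain ⟨L, a, h, hL, hmono, hL'⟩ := hC.exists_isApproximating hG
  exact ⟨_, h.approxBound_of_homZero hL hmono hL' hG hb⟩

/-- This is why `FinDimLE` can omit the condition `pd < ⊤` that appears in `fpd`. -/
lemma SelfExtLE.exists_projDimLE {c : ℤ} (hc : SelfExtLE G c) (hG : IsCompactGenerator G) {X : C}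
    (hX : IsSmall X) : ∃ n, ProjDimLE G X n := by
  obtain ⟨b, hb⟩ := hG.finBuiltIn hX
  exact ⟨b + c, fun Y _ hY => hc.homZero (k := -b) hG.1.isSmall (by lia)
    (hb.built.mono Set.Icc_subset_Ici_self) hY⟩

end WeaklyApproximable

/-! ### Transport of aisles, coaisles and dimension bounds along triangle functors. -/

section Transfer

variable {C : Type u₁} [Category.{v} C] [HasZeroObject C] [HasShift C ℤ] [Preadditive C]
  [∀ n : ℤ, (shiftFunctor C n).Additive] [Pretriangulated C]
  {D : Type u₂} [Category.{v} D] [HasZeroObject D] [HasShift D ℤ] [Preadditive D]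
  [∀ n : ℤ, (shiftFunctor D n).Additive] [Pretriangulated D]
  (F : C ⥤ D) [F.CommShift ℤ] [F.IsTriangulated] {G : C} {H : D}

lemma BuiltIn.map [PreservesColimitsOfSize.{v, v} F] {I J K : Set ℤ} {X : C}
    (hX : BuiltIn G I X) (hG : BuiltIn H J (F.obj G)) (hK : ∀ i ∈ I, ∀ j ∈ J, i + j ∈ K) :
    BuiltIn H K (F.obj X) := by
  refine Built.map F hX ?_
  rintro _ ⟨i, hi, ⟨e⟩⟩
  refine Built.of_iso (F.mapIso e ≪≫ (F.commShiftIso (-i)).app G).symm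
    (BuiltIn.shift hG (-i) fun j hj => ?_)
  rw [show j - -i = i + j by lia]
  exact hK i hi j hj

lemma FinBuiltIn.map {I J K : Set ℤ} {X : C} (hX : FinBuiltIn G I X)
    (hG : FinBuiltIn H J (F.obj G)) (hK : ∀ i ∈ I, ∀ j ∈ J, i + j ∈ K) :
    FinBuiltIn H K (F.obj X) := by
  refine FinBuilt.map F hX ?_
  rintro _ ⟨i, hi, ⟨e⟩⟩
  refine FinBuilt.of_iso (F.mapIso e ≪≫ (F.commShiftIso (-i)).app G).symm
    (FinBuiltIn.shift hG (-i) fun j hj => ?_)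
  rw [show j - -i = i + j by lia]
  exact hK i hi j hj

lemma AisleLE.map [PreservesColimitsOfSize.{v, v} F] {n d : ℤ} {X : C} (hX : AisleLE G n X)
    (hG : AisleLE H d (F.obj G)) : AisleLE H (n + d) (F.obj X) :=
  BuiltIn.map F hX hG fun i hi j hj => show i + j ≤ n + d from add_le_add hi hj

lemma homZero_map_generator {d n i : ℤ} (hG : AisleLE H d (F.obj G)) {Y : D}
    (hY : AisleGE H n Y) (hi : i < n - d) : HomZero (F.obj (G⟦-i⟧)) Y := by
  refine HomZero.of_iso_left ?_ ((F.commShiftIso (-i)).app G).symm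
  exact homZero_of_forall_generator (hG.shift (-i) (d + i) (by lia)) fun j (hj : j ≤ d + i) =>
    hY j (by lia)

lemma AisleGE.rightAdjoint [F.Additive] {U : D ⥤ C} (adj : F ⊣ U) {n d : ℤ}
    (hG : AisleLE H d (F.obj G)) {Y : D} (hY : AisleGE H n Y) : AisleGE G (n - d) (U.obj Y) :=
  fun _ hi => (homZero_obj_iff_of_adjunction adj _ _).1 (homZero_map_generator F hG hY hi)

lemma AisleGE.of_map [F.Additive] [F.Full] [F.Faithful] {n d : ℤ} (hG : AisleLE H d (F.obj G))
    {X : C} (hX : AisleGE H n (F.obj X)) : AisleGE G (n - d) X :=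
  fun _ hi => (homZero_map_iff F _ _).1 (homZero_map_generator F hG hX hi)

lemma AisleGE.map_of_zero {e : ℤ} (h : ∀ X, AisleGE G 0 X → AisleGE H (-e) (F.obj X)) {n : ℤ}
    {X : C} (hX : AisleGE G n X) : AisleGE H (n - e) (F.obj X) :=
  (aisleGE_shift_iff _ n _ (by lia)).1
    ((h _ (hX.shift n 0 (by lia))).of_iso ((F.commShiftIso n).app X))

/-- Finitistic dimension bounds pull back along fully faithful functors that preserve compact
objects and the two halves of the t-structures up to shifts. -/
lemma FinDimLE.of_fullyFaithful [F.Additive] [F.Full] [F.Faithful]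
    (hsmall : ∀ X, IsSmall X → IsSmall (F.obj X)) {d e : ℤ}
    (hLE : ∀ {n : ℤ} {X : C}, AisleLE G n X → AisleLE H (n + d) (F.obj X))
    (hGE : ∀ {n : ℤ} {X : C}, AisleGE G n X → AisleGE H (n - e) (F.obj X)) {p : ℤ}
    (h : FinDimLE H p) : FinDimLE G (p + e + d) := by
  have hb {X : C} (hX : AisleBounded G X) : AisleBounded H (F.obj X) := by
    obtain ⟨⟨n, hn⟩, ⟨m, hm⟩⟩ := hX
    exact ⟨⟨_, hLE hn⟩, ⟨_, hGE hm⟩⟩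
  intro X hX hXb hX0 Y hYb hY
  rw [← homZero_map_iff F]
  exact h.projDimLE (hsmall X hX) (hb hXb) e (by simpa using hGE hX0) _ (hb hYb)
    ((hLE hY).mono (by lia))

/-- The object `F.obj G` lies in the aisle at level `β` and in the coaisle at level `α - b`. Through
this, boundedness of `GS` passes to `GR` and `GT`. -/
lemma SelfCoextLE.of_fullyFaithful [F.Additive] [F.Full] [F.Faithful] (hH : IsSmall H) {b α β : ℤ}
    (hb : SelfCoextLE H b) (hF : FinBuiltIn H (Set.Icc α β) (F.obj G)) :
    SelfCoextLE G (b + (β - α)) := by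
  intro i hi
  rw [← homZero_map_iff F]
  have := homZero_map_generator F (i := -i) (hF.built.mono Set.Icc_subset_Iic_self)
    (hb.aisleGE hH (hF.built.mono Set.Icc_subset_Ici_self)) (by lia)
  rwa [neg_neg] at this

end Transfer

/-! ### Lower bounds for the finitistic dimension of a nonzero category. -/

section Nonzero

variable {C : Type u} [Category.{v} C] [HasZeroObject C] [HasShift C ℤ] [Preadditive C]
  [∀ n : ℤ, (shiftFunctor C n).Additive] [Pretriangulated C] {G : C}

lemma IsCompactGenerator.not_homZero_self (hG : IsCompactGenerator G)
    (hC : ∃ X : C, ¬ IsZero X) : ¬ HomZero G G := by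
  intro h
  obtain ⟨X, hX⟩ := hC
  have hGX : HomZero G X := Built.homZero_right (built_of_bigGen (hG.2 X)) hG.1.isSmall <| by
    rintro _ ⟨i, -, ⟨e⟩⟩
    have hz : IsZero G := (IsZero.iff_id_eq_zero G).2 (h _)
    exact fun f => hz.eq_of_src _ _
  refine hX ((IsZero.iff_id_eq_zero X).2 (homZero_of_forall_generator
    (built_of_bigGen (hG.2 X)) (fun i _ f => ?_) _))
  have hz : IsZero G := (IsZero.iff_id_eq_zero G).2 (h _)
  exact ((shiftFunctor C (-i)).map_isZero hz).eq_of_src _ _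

/-- The test object is `G` itself: it lies in the coaisle at level `-b`, so its projective dimension
is at most `p + b`. If that were negative, the identity of `G` would vanish. -/
lemma FinDimLE.nonneg_add (hG : IsCompactGenerator G) (hC : ∃ X : C, ¬ IsZero X) {p b : ℤ}
    (hp : FinDimLE G p) (hb : SelfCoextLE G b) : 0 ≤ p + b := by
  by_contra hneg
  have hG0 : AisleLE G 0 G := .of (shiftsIn_zero (Set.mem_Iic.2 le_rfl))
  have hGb : AisleGE G (-b) G := fun i hi => hb _ (by lia)
  exact hG.not_homZero_self hC (hp.projDimLE hG.1.isSmall ⟨⟨_, hG0⟩, ⟨_, hGb⟩⟩ b hGb G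
    ⟨⟨_, hG0⟩, ⟨_, hGb⟩⟩ (hG0.mono (by lia)))

end Nonzero

/-! ### The three integer bounds for a recollement. -/

section Recollement

variable {R : Type u₁} [Category.{v} R] [HasZeroObject R] [HasShift R ℤ] [Preadditive R]
  [∀ n : ℤ, (shiftFunctor R n).Additive] [Pretriangulated R]
  {S : Type u₂} [Category.{v} S] [HasZeroObject S] [HasShift S ℤ] [Preadditive S]
  [∀ n : ℤ, (shiftFunctor S n).Additive] [Pretriangulated S]
  {T : Type u₃} [Category.{v} T] [HasZeroObject T] [HasShift T ℤ] [Preadditive T]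
  [∀ n : ℤ, (shiftFunctor T n).Additive] [Pretriangulated T]

attribute [instance] Recollement.iPullShift Recollement.iPushShift Recollement.jShriekShift
  Recollement.iPull_triangulated Recollement.iPush_triangulated Recollement.jShriek_triangulated
  Recollement.iPush_full Recollement.iPush_faithful Recollement.jShriek_full
  Recollement.jShriek_faithful

namespace Recollement

variable (ρ : Recollement R S T)

instance : PreservesColimitsOfSize.{v, v} ρ.iPush := ρ.adjI'.leftAdjoint_preservesColimits
instance : PreservesColimitsOfSize.{v, v} ρ.jShriek := ρ.adjJ.leftAdjoint_preservesColimits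
instance : PreservesColimitsOfSize.{v, v} ρ.jPull := ρ.adjJ'.leftAdjoint_preservesColimits

lemma isSmall_iPull {X : S} (hX : IsSmall X) : IsSmall (ρ.iPull.obj X) :=
  hX.obj_of_adjunction ρ.adjI

lemma isSmall_jShriek {X : T} (hX : IsSmall X) : IsSmall (ρ.jShriek.obj X) :=
  hX.obj_of_adjunction ρ.adjJ

variable {GR : R} {GS : S} {GT : T}

lemma isSmall_iPush (hGR : IsCompactGenerator GR) (hi : IsSmall (ρ.iPush.obj GR)) {X : R}
    (hX : IsSmall X) : IsSmall (ρ.iPush.obj X) := by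
  obtain ⟨b, hb⟩ := hGR.finBuiltIn hX
  refine FinBuilt.isSmall (A := shiftsIn (ρ.iPush.obj GR) Set.univ)
    (FinBuiltIn.map ρ.iPush hb (.of (shiftsIn_zero (Set.mem_singleton 0))) (by simp))
    fun _ hY => isSmall_of_shiftsIn hi hY

/-- In the triangle on `X`, both `X` and `i_* i^* X` are compact, so `j_! j^* X` is; the fully
faithful, coproduct-preserving `j_!` reflects compactness. -/
lemma isSmall_jPull (hGR : IsCompactGenerator GR) (hi : IsSmall (ρ.iPush.obj GR)) {X : S}
    (hX : IsSmall X) : IsSmall (ρ.jPull.obj X) := by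
  obtain ⟨h, hT⟩ := ρ.triangle₂ X
  exact IsSmall.of_obj (F := ρ.jShriek)
    (IsSmall.ext₁ _ hT hX (ρ.isSmall_iPush hGR hi (ρ.isSmall_iPull hX)))

/-- The bound for the middle term of a recollement, in terms of integral bounds for all the
invariants involved. -/
lemma finDimLE_middle (hGR : IsCompactGenerator GR) (hGS : IsCompactGenerator GS)
    (hGT : IsCompactGenerator GT) (hi : IsSmall (ρ.iPush.obj GR)) {b c : ℤ}
    (hb : SelfCoextLE GS b) (hc : SelfExtLE GS c) {α β γ δ : ℤ}
    (hR : FinBuiltIn GS (Set.Icc α β) (ρ.iPush.obj GR))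
    (hT : FinBuiltIn GS (Set.Icc γ δ) (ρ.jShriek.obj GT)) {r t a a' : ℤ}
    (hr : FinDimLE GR r) (ht : FinDimLE GT t) (ha : ApproxBound GR a) (ha' : ApproxBound GT a')
    (hr0 : 0 ≤ r + (β - α) + a + b + 1) (ht0 : 0 ≤ t + (δ - γ) + a' + b + 1) :
    FinDimLE GS (r + (β - α) + a + t + (δ - γ) + a' + b + c + 1) := by
  intro X hX hXb hX0
  have hRc := hR.built.mono Set.Icc_subset_Iic_self
  have hTc := hT.built.mono Set.Icc_subset_Iic_self
  have hZ := ρ.isSmall_jPull hGR hi hX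
  have hW := ρ.isSmall_iPull hX
  have hZ0 : AisleGE GT (-δ) (ρ.jPull.obj X) := by
    simpa using AisleGE.rightAdjoint ρ.jShriek ρ.adjJ hTc hX0
  have hZb := hGT.aisleBounded (hb.of_fullyFaithful ρ.jShriek hGS.1.isSmall hT) hZ
  have hZ' := FinBuiltIn.map ρ.jShriek (K := Set.Ici (-(t + (δ - γ) + a')))
    (ha' _ _ hZ (ht.projDimLE hZ hZb δ hZ0)) hT fun i hi' j hj => by
      have := hj.1
      simp only [Set.mem_Ici] at hi' ⊢
      lia
  obtain ⟨w, hw⟩ := ρ.triangle₂ X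
  have hZ'' := hb.aisleGE hGS.1.isSmall hZ'.built
  -- `i_* i^* X` is an extension of `(j_! j^* X)⟦1⟧` by `X`; this shift accounts for the `+ 1` in
  -- the bound. By `ht0`, the lower bound 0 of `X` is not the smaller of the two.
  have hW0 : AisleGE GS (-(t + (δ - γ) + a' + b + 1)) (ρ.iPush.obj (ρ.iPull.obj X)) :=
    fun i hi' => HomZero.ext_right _ (rot_of_distTriang _ hw) (hX0 i (by lia))
      (hZ''.shift 1 (-(t + (δ - γ) + a') - b - 1) (by lia) i (by lia))
  have hW1 := AisleGE.of_map ρ.iPush hRc hW0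
  have hWb := hGR.aisleBounded (hb.of_fullyFaithful ρ.iPush hGS.1.isSmall hR) hW
  have hW' := FinBuiltIn.map ρ.iPush
    (K := Set.Ici (-(r + (t + (δ - γ) + a' + b + 1) + (β - α) + a)))
    (ha _ _ hW (hr.projDimLE hW hWb (t + (δ - γ) + a' + b + 1 + β)
      (hW1.mono (by lia)))) hR fun i hi' j hj => by
      have := hj.1
      simp only [Set.mem_Ici] at hi' ⊢
      lia
  intro Y _ hY
  -- The bound is dictated by `i_* i^* X`; `hr0` makes it large enough for `j_! j^* X` as well.
  exact HomZero.ext_left _ hw (hc.homZero hGS.1.isSmall (by lia) hZ'.built hY)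
    (hc.homZero hGS.1.isSmall (by lia) hW'.built hY)

/-- The bound for the left outer term of a recollement, for an arbitrary bound on the image of
the aisle. -/
lemma finDimLE_left (hGR : IsCompactGenerator GR) (hi : IsSmall (ρ.iPush.obj GR)) {β d : ℤ}
    (hS : AisleLE GR β (ρ.iPull.obj GS))
    (hd : ∀ {X : R}, AisleLE GR 0 X → AisleLE GS d (ρ.iPush.obj X)) {p : ℤ}
    (hp : FinDimLE GS p) : FinDimLE GR (p + β + d) :=
  FinDimLE.of_fullyFaithful ρ.iPush (fun _ hX => ρ.isSmall_iPush hGR hi hX)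
    (fun {n X} hX => (aisleLE_shift_iff _ n _ (by lia)).1
      ((hd (hX.shift n 0 (by lia))).of_iso ((ρ.iPush.commShiftIso n).app X)))
    (fun hX => AisleGE.rightAdjoint ρ.iPull ρ.adjI hS hX) hp

/-- By adjunction, `Hom(GS⟦-i⟧, i_* X) = Hom(i^* GS⟦-i⟧, X)` vanishes for `i > c - α`, and
approximation turns this into aisle membership at cost `a`. The level `n` only provides some a
priori upper bound and does not enter the result. -/
lemma aisleLE_iPush (hGR : IsCompactGenerator GR) {c : ℤ} (hc : SelfExtLE GR c) {α β a n : ℤ}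
    (hS : FinBuiltIn GR (Set.Icc α β) (ρ.iPull.obj GS)) (ha : IsApproximating GS (AisleLE GS) a)
    (hn : AisleLE GS n (ρ.iPush.obj GR)) {X : R} (hX : AisleLE GR 0 X) :
    AisleLE GS (c - α + a) (ρ.iPush.obj X) := by
  refine ha.aisleLE (hX.map ρ.iPush hn) fun i hi => ?_
  rw [← homZero_obj_iff_of_adjunction ρ.adjI]
  refine HomZero.of_iso_left ?_ ((ρ.iPull.commShiftIso (-i)).app GS).symm
  refine hc.homZero (k := α + i) hGR.1.isSmall (by lia) (hS.built.shift (-i) fun j hj => ?_) hX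
  have := hj.1
  simp only [Set.mem_Ici]
  lia

/-- The bound for the right outer term of a recollement. -/
lemma finDimLE_right {e d : ℤ} (he : ∀ Z, AisleGE GT 0 Z → AisleGE GS (-e) (ρ.jShriek.obj Z))
    (hd : AisleLE GS d (ρ.jShriek.obj GT)) {p : ℤ} (hp : FinDimLE GS p) :
    FinDimLE GT (p + e + d) :=
  FinDimLE.of_fullyFaithful ρ.jShriek (fun _ hX => ρ.isSmall_jShriek hX)
    (fun hX => hX.map ρ.jShriek hd) (fun hX => hX.map_of_zero ρ.jShriek he) hp

end Recollement

end Recollement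
-- Extended real arithmetic.
section EReal

lemma exists_nat_le_iInf {P : ℕ → Prop}
    (h : (⨅ (n : ℕ) (_ : P n), (((n : ℕ) : ℝ) : EReal)) ≠ ⊤) :
    ∃ n, P n ∧ (((n : ℕ) : ℝ) : EReal) ≤ ⨅ (n : ℕ) (_ : P n), (((n : ℕ) : ℝ) : EReal) := by
  classical
  have hP : ∃ n, P n := by
    by_contra hP
    push Not at hP
    exact h (by simp [hP])
  refine ⟨Nat.find hP, Nat.find_spec hP, le_iInf₂ fun n hn => ?_⟩
  exact EReal.coe_le_coe_iff.2 (Nat.cast_le.2 (Nat.find_min' hP hn))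

/-- Since `⊥ + ⊤ = ⊥` in `EReal`, both summands must be known to differ from `⊥`. -/
lemma ne_top_of_add_ne_top {x y : EReal} (hx : x ≠ ⊥) (hy : y ≠ ⊥) (h : x + y ≠ ⊤) :
    x ≠ ⊤ ∧ y ≠ ⊤ := by
  refine ⟨fun e => h ?_, fun e => h ?_⟩
  · rw [e, EReal.top_add_of_ne_bot hy]
  · rw [e, EReal.add_top_of_ne_bot hx]

lemma add_ne_bot {x y : EReal} (hx : x ≠ ⊥) (hy : y ≠ ⊥) : x + y ≠ ⊥ := by
  simp [EReal.add_eq_bot_iff, hx, hy]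

end EReal

/-! ### Passage between the extended-real invariants and attained integer bounds. -/

section Invariants

variable {C : Type u} [Category.{v} C] [HasZeroObject C] [HasShift C ℤ] [Preadditive C]
  [∀ n : ℤ, (shiftFunctor C n).Additive] [Pretriangulated C] {G : C}

lemma projDimLE_of_pd_le [HasCoproducts.{v} C] {X : C} {r : ℝ} (h : pd G X ≤ (r : EReal)) :
    ProjDimLE G X ⌊r⌋ := by
  have h' : pd G X < ((⌊r⌋ + 1 : ℝ) : EReal) :=
    h.trans_lt (EReal.coe_lt_coe_iff.2 (Int.lt_floor_add_one r))
  simp only [pd, iInf_lt_iff] at h'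
  obtain ⟨m, hm, hmr⟩ := h'
  refine (projDimLE_iff.2 hm).mono ?_
  have : (m : ℝ) < ((⌊r⌋ + 1 : ℤ) : ℝ) := by
    push_cast
    exact EReal.coe_lt_coe_iff.1 hmr
  exact Int.lt_add_one_iff.1 (Int.cast_lt.1 this)

lemma pd_le [HasCoproducts.{v} C] {X : C} {n : ℤ} (h : ProjDimLE G X n) :
    pd G X ≤ (((n : ℤ) : ℝ) : EReal) :=
  iInf₂_le n (projDimLE_iff.1 h)

lemma fpd_le [HasCoproducts.{v} C] {p : ℤ} (h : FinDimLE G p) :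
    fpd G ≤ (((p : ℤ) : ℝ) : EReal) :=
  iSup₂_le fun X ⟨h₁, h₂, h₃, _⟩ =>
    pd_le (h X h₁.isSmall (isBoundedObj_iff.1 h₂) (tGE_iff.1 h₃))

lemma fpd_lt_top [HasCoproducts.{v} C] {p : ℤ} (h : FinDimLE G p) : fpd G < ⊤ :=
  (fpd_le h).trans_lt (EReal.coe_lt_top _)

lemma fpd_eq_bot [HasCoproducts.{v} C] (h : ∀ p, FinDimLE G p) : fpd G = ⊥ := by
  rw [EReal.eq_bot_iff_forall_lt]
  intro y
  refine (fpd_le (h (⌊y⌋ - 1))).trans_lt (EReal.coe_lt_coe_iff.2 ?_)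
  have := Int.floor_le y
  push_cast
  linarith

lemma finDimLE_of_fpd_le [HasCoproducts.{v} C] (hG : IsCompactGenerator G) {c : ℤ}
    (hc : SelfExtLE G c) [IsTriangulated C] {r : ℝ} (h : fpd G ≤ (r : EReal)) :
    FinDimLE G ⌊r⌋ := by
  intro X hX hXb hX0
  obtain ⟨n, hn⟩ := hc.exists_projDimLE hG hX
  refine projDimLE_of_pd_le (le_trans ?_ h)
  exact le_iSup₂_of_le X ⟨hX.isCompactObj, isBoundedObj_iff.2 hXb, tGE_iff.2 hX0,
    (pd_le hn).trans_lt (EReal.coe_lt_top _)⟩ le_rfl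

lemma finDimLE_of_fpd_eq_bot [HasCoproducts.{v} C] (hG : IsCompactGenerator G) {c : ℤ}
    (hc : SelfExtLE G c) [IsTriangulated C] (h : fpd G = ⊥) (p : ℤ) : FinDimLE G p := by
  simpa using finDimLE_of_fpd_le hG hc (r := p) (by rw [h]; exact bot_le)

lemma exists_finDimLE_le_fpd [HasCoproducts.{v} C] (hG : IsCompactGenerator G) {c : ℤ}
    (hc : SelfExtLE G c) [IsTriangulated C] (h : fpd G ≠ ⊤) (h' : fpd G ≠ ⊥) :
    ∃ p : ℤ, FinDimLE G p ∧ (((p : ℤ) : ℝ) : EReal) ≤ fpd G := by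
  refine ⟨⌊(fpd G).toReal⌋, finDimLE_of_fpd_le hG hc (EReal.coe_toReal h h').ge, ?_⟩
  refine (EReal.coe_le_coe_iff.2 (Int.floor_le _)).trans (EReal.coe_toReal h h').le

lemma exists_finDimLE [HasCoproducts.{v} C] (hG : IsCompactGenerator G) {c : ℤ}
    (hc : SelfExtLE G c) [IsTriangulated C] (h : fpd G < ⊤) : ∃ p : ℤ, FinDimLE G p := by
  by_cases h' : fpd G = ⊥
  · exact ⟨0, finDimLE_of_fpd_eq_bot hG hc h' 0⟩
  · obtain ⟨p, hp, -⟩ := exists_finDimLE_le_fpd hG hc h.ne h'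
    exact ⟨p, hp⟩

/-- The value `⊥` would allow the bound `-b - 1`, contradicting `FinDimLE.nonneg_add`. -/
lemma fpd_ne_bot [HasCoproducts.{v} C] [IsTriangulated C] (hG : IsCompactGenerator G) {b c : ℤ}
    (hb : SelfCoextLE G b) (hc : SelfExtLE G c) (hC : ∃ X : C, ¬ IsZero X) : fpd G ≠ ⊥ := by
  intro h
  have := (finDimLE_of_fpd_eq_bot hG hc h (-b - 1)).nonneg_add hG hC hb
  lia

lemma oMinus_ne_bot : oMinus G ≠ ⊥ :=
  (EReal.bot_lt_zero.trans_le (le_iInf₂ fun n _ => by positivity)).ne'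

lemma oPlus_ne_bot : oPlus G ≠ ⊥ :=
  (EReal.bot_lt_zero.trans_le (le_iInf₂ fun n _ => by positivity)).ne'

lemma width_ne_bot {P : C} : width G P ≠ ⊥ := by
  refine (EReal.bot_lt_zero.trans_le (le_iInf fun α => le_iInf₂ fun β h => ?_)).ne'
  exact EReal.coe_nonneg.2 (Int.cast_nonneg (sub_nonneg.2 h.1))

lemma approxIndex_nonneg [HasCoproducts.{v} C] : 0 ≤ approxIndex G := by
  refine le_iSup₂_of_le (0 : C) (tLE_iff.2 (.zero (isZero_zero C))) ?_
  exact le_iInf₂ fun n _ => by positivity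

lemma approxIndex_ne_bot [HasCoproducts.{v} C] : approxIndex G ≠ ⊥ :=
  (EReal.bot_lt_zero.trans_le approxIndex_nonneg).ne'

lemma exists_selfCoextLE_le_oMinus (h : oMinus G ≠ ⊤) :
    ∃ b : ℤ, SelfCoextLE G b ∧ (((b : ℤ) : ℝ) : EReal) ≤ oMinus G := by
  obtain ⟨n, hn, hn'⟩ := exists_nat_le_iInf h
  exact ⟨n, hn, by rwa [Int.cast_natCast]⟩

lemma exists_selfExtLE_le_oPlus (h : oPlus G ≠ ⊤) :
    ∃ c : ℤ, SelfExtLE G c ∧ (((c : ℤ) : ℝ) : EReal) ≤ oPlus G := by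
  obtain ⟨n, hn, hn'⟩ := exists_nat_le_iInf h
  exact ⟨n, hn, by rwa [Int.cast_natCast]⟩

lemma exists_finBuiltIn_le_width {P : C} (h : width G P ≠ ⊤) :
    ∃ α β : ℤ, FinBuiltIn G (Set.Icc α β) P ∧ (((β - α : ℤ) : ℝ) : EReal) ≤ width G P := by
  classical
  have hP : ∃ (n : ℕ) (α β : ℤ), β - α = n ∧ gen G (Set.Icc α β) P := by
    by_contra hP
    push Not at hP
    refine h (iInf_eq_top.2 fun α => iInf₂_eq_top.2 fun β hαβ => ?_)
    exact (hP (β - α).toNat α β (Int.toNat_of_nonneg (sub_nonneg.2 hαβ.1)).symm hαβ.2).elim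
  obtain ⟨α, β, hαβ, hg⟩ := Nat.find_spec hP
  refine ⟨α, β, finBuilt_of_gen hg, le_iInf fun α' => le_iInf₂ fun β' h' => ?_⟩
  have := Nat.find_min' hP ⟨α', β', (Int.toNat_of_nonneg (sub_nonneg.2 h'.1)).symm, h'.2⟩
  refine EReal.coe_le_coe_iff.2 (Int.cast_le.2 ?_)
  lia

lemma exists_isApproximating_le_approxIndex [HasCoproducts.{v} C] (h : approxIndex G ≠ ⊤) :
    ∃ a : ℤ, 0 ≤ a ∧ IsApproximating G (AisleLE G) a ∧
      (((a : ℤ) : ℝ) : EReal) ≤ approxIndex G := by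
  have hr := EReal.coe_toReal h approxIndex_ne_bot
  refine ⟨⌊(approxIndex G).toReal⌋, Int.floor_nonneg.2 (EReal.toReal_nonneg approxIndex_nonneg),
    ⟨fun h k m hm => h.shift k m hm, fun M hM => ?_⟩,
    (EReal.coe_le_coe_iff.2 (Int.floor_le _)).trans hr.le⟩
  -- The strict inequality yields an actual approximation whose integer index is at most the floor.
  have h' : approxIndexObj G M < ((⌊(approxIndex G).toReal⌋ + 1 : ℝ) : EReal) :=
    ((le_iSup₂_of_le M (tLE_iff.2 hM) le_rfl : _ ≤ approxIndex G).trans hr.ge).trans_lt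
      (EReal.coe_lt_coe_iff.2 (Int.lt_floor_add_one _))
  simp only [approxIndexObj, iInf_lt_iff] at h'
  obtain ⟨n, ⟨E, D, f, g, w, hT, hE, hD⟩, hn⟩ := h'
  have hn' : (n : ℤ) < ⌊(approxIndex G).toReal⌋ + 1 := by
    have := EReal.coe_lt_coe_iff.1 hn
    exact_mod_cast this
  exact ⟨E, D, f, g, w, hT,
    BuiltIn.mono (Set.Icc_subset_Icc (by lia) (by lia)) (built_of_bigGen hE), tLE_iff.1 hD⟩

end Invariants
end TriCat

/-! ### Assembly of the extended-real inequalities. -/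

theorem theorem1p6
    {R : Type u₁} [Category.{v} R] [HasZeroObject R] [HasShift R ℤ] [Preadditive R]
    [∀ n : ℤ, (shiftFunctor R n).Additive] [Pretriangulated R] [IsTriangulated R]
    [HasCoproducts.{v} R]
    {S : Type u₂} [Category.{v} S] [HasZeroObject S] [HasShift S ℤ] [Preadditive S]
    [∀ n : ℤ, (shiftFunctor S n).Additive] [Pretriangulated S] [IsTriangulated S]
    [HasCoproducts.{v} S]
    {T : Type u₃} [Category.{v} T] [HasZeroObject T] [HasShift T ℤ] [Preadditive T]
    [∀ n : ℤ, (shiftFunctor T n).Additive] [Pretriangulated T] [IsTriangulated T]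
    [HasCoproducts.{v} T]
    (hR : TriCat.IsWeaklyApproximable R) (hS : TriCat.IsWeaklyApproximable S)
    (hT : TriCat.IsWeaklyApproximable T)
    (GR : R) (GS : S) (GT : T)
    (hGR : TriCat.IsCompactGenerator GR) (hGS : TriCat.IsCompactGenerator GS)
    (hGT : TriCat.IsCompactGenerator GT)
    (ρ : TriCat.Recollement R S T) :
    -- bounded `GS` and compact `i_* GR`
    (TriCat.IsBoundedGen GS → TriCat.IsCompactObj (ρ.iPush.obj GR) →
      -- bounds for the middle term (the inequality for nonzero outer terms)
      (((∃ X : R, ¬ IsZero X) → (∃ Z : T, ¬ IsZero Z) →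
          TriCat.fpd GS ≤
            TriCat.fpd GR + TriCat.width GS (ρ.iPush.obj GR) + TriCat.approxIndex GR
              + TriCat.fpd GT + TriCat.width GS (ρ.jShriek.obj GT) + TriCat.approxIndex GT
              + TriCat.oMinus GS + TriCat.oPlus GS + 1) ∧
        (TriCat.fpd GR < ⊤ → TriCat.fpd GT < ⊤ → TriCat.fpd GS < ⊤)) ∧
      -- bounds for the left outer term
      (TriCat.fpd GR ≤
          TriCat.fpd GS + TriCat.width GR (ρ.iPull.obj GS) + TriCat.approxIndex GS
            + TriCat.oPlus GR ∧
        (TriCat.fpd GS < ⊤ → TriCat.fpd GR < ⊤))) ∧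
    -- bounds for the right outer term
    (∀ e : ℤ, (∀ Z : T, TriCat.tGE GT 0 Z → TriCat.tGE GS (-e) (ρ.jShriek.obj Z)) →
      (∀ d : ℤ, TriCat.gen GS (Set.Iic d) (ρ.jShriek.obj GT) →
        TriCat.fpd GT ≤ TriCat.fpd GS + ((e : ℝ) : EReal) + ((d : ℝ) : EReal)) ∧
      (TriCat.fpd GS < ⊤ → TriCat.fpd GT < ⊤)) := by
  open TriCat in
  obtain ⟨cR, hcR⟩ := hR.exists_selfExtLE hGR
  obtain ⟨cS, hcS⟩ := hS.exists_selfExtLE hGS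
  obtain ⟨cT, hcT⟩ := hT.exists_selfExtLE hGT
  have hj := ρ.isSmall_jShriek hGT.1.isSmall
  refine ⟨fun hGSb hi => ?_, fun e he => ?_⟩
  · replace hi := hi.isSmall
    obtain ⟨bS, hbS⟩ := hGSb.exists_selfCoextLE
    obtain ⟨l, hl⟩ := hGS.finBuiltIn hi
    obtain ⟨m, hm⟩ := hGS.finBuiltIn hj
    have hbR := hbS.of_fullyFaithful ρ.iPush hGS.1.isSmall hl
    have hbT := hbS.of_fullyFaithful ρ.jShriek hGS.1.isSmall hm
    obtain ⟨β₀, hβ₀⟩ := hGR.exists_aisleLE (ρ.isSmall_iPull hGS.1.isSmall)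
    obtain ⟨n, hn⟩ := hGS.exists_aisleLE hi
    -- A crude bound with uncontrolled constants, enough for finiteness and for the case `fpd GS =
    -- ⊥`.
    have hleft {p : ℤ} (hp : FinDimLE GS p) : FinDimLE GR (p + β₀ + (0 + n)) :=
      ρ.finDimLE_left hGR hi hβ₀ (fun hX => hX.map ρ.iPush hn) hp
    refine ⟨⟨fun hR0 hT0 => ?_, fun hfR hfT => ?_⟩, ?_, fun hfS => ?_⟩
    · by_cases htop : fpd GR + width GS (ρ.iPush.obj GR) + approxIndex GR
              + fpd GT + width GS (ρ.jShriek.obj GT) + approxIndex GT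
              + oMinus GS + oPlus GS + 1 = ⊤
      · rw [htop]
        exact le_top
      -- No partial sum is `⊥`, because `R` and `T` are nonzero; since the total is not `⊤`, every
      -- summand is then finite and is bounded below by an integer bound of its kind.
      have b₁ := fpd_ne_bot hGR hbR hcR hR0
      have b₂ := add_ne_bot b₁ (width_ne_bot (G := GS) (P := ρ.iPush.obj GR))
      have b₃ := add_ne_bot b₂ (approxIndex_ne_bot (G := GR))
      have b₄ := add_ne_bot b₃ (fpd_ne_bot hGT hbT hcT hT0)
      have b₅ := add_ne_bot b₄ (width_ne_bot (G := GS) (P := ρ.jShriek.obj GT))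
      have b₆ := add_ne_bot b₅ (approxIndex_ne_bot (G := GT))
      have b₇ := add_ne_bot b₆ (oMinus_ne_bot (G := GS))
      have b₈ := add_ne_bot b₇ (oPlus_ne_bot (G := GS))
      have t₈ := (ne_top_of_add_ne_top b₈ (EReal.coe_ne_bot 1) htop).1
      obtain ⟨t₇, toP⟩ := ne_top_of_add_ne_top b₇ oPlus_ne_bot t₈
      obtain ⟨t₆, toM⟩ := ne_top_of_add_ne_top b₆ oMinus_ne_bot t₇
      obtain ⟨t₅, taT⟩ := ne_top_of_add_ne_top b₅ approxIndex_ne_bot t₆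
      obtain ⟨t₄, twT⟩ := ne_top_of_add_ne_top b₄ width_ne_bot t₅
      obtain ⟨t₃, tfT⟩ := ne_top_of_add_ne_top b₃ (fpd_ne_bot hGT hbT hcT hT0) t₄
      obtain ⟨t₂, taR⟩ := ne_top_of_add_ne_top b₂ approxIndex_ne_bot t₃
      obtain ⟨tfR, twR⟩ := ne_top_of_add_ne_top b₁ width_ne_bot t₂
      obtain ⟨r, hr, hr'⟩ := exists_finDimLE_le_fpd hGR hcR tfR b₁
      obtain ⟨t, ht, ht'⟩ := exists_finDimLE_le_fpd hGT hcT tfT (fpd_ne_bot hGT hbT hcT hT0)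
      obtain ⟨α, β, hRw, hRw'⟩ := exists_finBuiltIn_le_width twR
      obtain ⟨γ, δ, hTw, hTw'⟩ := exists_finBuiltIn_le_width twT
      obtain ⟨a, ha0, ha, ha'⟩ := exists_isApproximating_le_approxIndex taR
      obtain ⟨a₂, ha₂0, ha₂, ha₂'⟩ := exists_isApproximating_le_approxIndex taT
      obtain ⟨b, hb, hb'⟩ := exists_selfCoextLE_le_oMinus toM
      obtain ⟨c, hc, hc'⟩ := exists_selfExtLE_le_oPlus toP
      have pR := hr.nonneg_add hGR hR0 (hb.of_fullyFaithful ρ.iPush hGS.1.isSmall hRw)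
      have pT := ht.nonneg_add hGT hT0 (hb.of_fullyFaithful ρ.jShriek hGS.1.isSmall hTw)
      have key := fpd_le (ρ.finDimLE_middle hGR hGS hGT hi hb hc hRw hTw hr ht
        (ha.approxBound hGR hbR) (ha₂.approxBound hGT hbT) (by lia) (by lia))
      refine key.trans ?_
      have e : (((r + (β - α) + a + t + (δ - γ) + a₂ + b + c + 1 : ℤ) : ℝ) : EReal) =
          ((r : ℝ) : EReal) + (((β - α : ℤ) : ℝ) : EReal) + ((a : ℝ) : EReal) + ((t : ℝ) : EReal)
            + (((δ - γ : ℤ) : ℝ) : EReal) + ((a₂ : ℝ) : EReal) + ((b : ℝ) : EReal)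
            + ((c : ℝ) : EReal) + 1 := by
        push_cast
        rfl
      rw [e]
      gcongr
    · obtain ⟨r, hr⟩ := exists_finDimLE hGR hcR hfR
      obtain ⟨t, ht⟩ := exists_finDimLE hGT hcT hfT
      obtain ⟨a, ha⟩ := hR.exists_approxBound hGR hbR
      obtain ⟨a', ha'⟩ := hT.exists_approxBound hGT hbT
      -- Enlarging `r` and `t` secures the nonnegativity conditions without assuming that `R` and
      -- `T` are nonzero.
      exact fpd_lt_top (ρ.finDimLE_middle hGR hGS hGT hi hbS hcS hl hm
        (hr.mono (show r ≤ r.natAbs + a.natAbs + bS.natAbs by lia))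
        (ht.mono (show t ≤ t.natAbs + a'.natAbs + bS.natAbs by lia)) ha ha'
        (by lia) (by lia))
    · by_cases hbot : fpd GS = ⊥
      -- If `fpd GS = ⊥` then the right side is `⊥`, so arbitrarily negative bounds for `GR` are
      -- required; they come from those for `GS`.
      · rw [fpd_eq_bot fun p =>
          (hleft (finDimLE_of_fpd_eq_bot hGS hcS hbot (p - β₀ - n))).mono (by lia)]
        exact bot_le
      by_cases htop : fpd GS + width GR (ρ.iPull.obj GS) + approxIndex GS + oPlus GR = ⊤
      · rw [htop]
        exact le_top
      have b₂ := add_ne_bot hbot (width_ne_bot (G := GR) (P := ρ.iPull.obj GS))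
      have b₃ := add_ne_bot b₂ (approxIndex_ne_bot (G := GS))
      obtain ⟨t₃, toP⟩ := ne_top_of_add_ne_top b₃ oPlus_ne_bot htop
      obtain ⟨t₂, ta⟩ := ne_top_of_add_ne_top b₂ approxIndex_ne_bot t₃
      obtain ⟨tf, tw⟩ := ne_top_of_add_ne_top hbot width_ne_bot t₂
      obtain ⟨p, hp, hp'⟩ := exists_finDimLE_le_fpd hGS hcS tf hbot
      obtain ⟨α, β, hw, hw'⟩ := exists_finBuiltIn_le_width tw
      obtain ⟨a, -, ha, ha'⟩ := exists_isApproximating_le_approxIndex ta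
      obtain ⟨c, hc, hc'⟩ := exists_selfExtLE_le_oPlus toP
      refine (fpd_le (ρ.finDimLE_left hGR hi (hw.built.mono Set.Icc_subset_Iic_self)
        (fun hX => ρ.aisleLE_iPush hGR hc hw ha hn hX) hp)).trans ?_
      have e : (((p + β + (c - α + a) : ℤ) : ℝ) : EReal) =
          ((p : ℝ) : EReal) + (((β - α : ℤ) : ℝ) : EReal) + ((a : ℝ) : EReal)
            + ((c : ℝ) : EReal) := by
        rw [show p + β + (c - α + a) = p + (β - α) + a + c by ring]
        push_cast
        rfl
      rw [e]
      gcongr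
    · obtain ⟨p, hp⟩ := exists_finDimLE hGS hcS hfS
      exact fpd_lt_top (hleft hp)
  · have he' (Z : T) (hZ : AisleGE GT 0 Z) : AisleGE GS (-e) (ρ.jShriek.obj Z) :=
      tGE_iff.1 (he Z (tGE_iff.2 hZ))
    refine ⟨fun d hd => ?_, fun hfS => ?_⟩
    · have hd' : AisleLE GS d (ρ.jShriek.obj GT) := (finBuilt_of_gen hd).built
      by_cases hbot : fpd GS = ⊥
      · rw [fpd_eq_bot fun p => 
          (ρ.finDimLE_right he' hd'
            (finDimLE_of_fpd_eq_bot hGS hcS hbot (p - e - d))).mono (by lia)]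
        exact bot_le
      by_cases htop : fpd GS = ⊤
      · simp [htop]
      obtain ⟨p, hp, hp'⟩ := exists_finDimLE_le_fpd hGS hcS htop hbot
      refine (fpd_le (ρ.finDimLE_right he' hd' hp)).trans ?_
      push_cast
      gcongr
    · obtain ⟨p, hp⟩ := exists_finDimLE hGS hcS hfS
      obtain ⟨d, hd⟩ := hGS.exists_aisleLE hj
      exact fpd_lt_top (ρ.finDimLE_right he' hd hp)
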